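/- Let $m>2$ and let $(M,g)$ be a spacetime of dimension $m$, i.e. $M$ is a connected smooth $m$-dimensional manifold and $g$ is a smooth Lorentzian metric on $M$ of signature $(-,+,\dots,+)$, with Levi-Civita connection $\nabla$. Suppose that $(M,g)$ is viable, i.e. that there is a complete timelike geodesic: a smooth curve $\gamma:\mathbb{R}\to M$, defined for all real times, with $\nabla_{\gamma'}\gamma'=0$ and $g(\gamma',\gamma')<0$. Let $\overline{\nabla}$ be a smooth symmetric (torsion-free) connection on the tangent bundle of $M$ such that * $\overline{\nabla}$ preserves the light cones of $g$: if $V$ is a $\overline{\nabla}$-parallel vector field along a smooth curve $c$ in $M$ and $g(V(t_0),V(t_0))=0$ for some $t_0$, then $g(V(t),V(t))=0$ for all $t$; * $\overline{\nabla}$ has the same Ricci tensor as $g$: $\mathrm{Ric}_{\overline{\nabla}}(u,w)=\mathrm{Ric}_{\nabla}(u,w)$ for all tangent vectors $u,w$ at a common point, where for a connection $D$, $\mathrm{Ric}_D(u,w)=\mathrm{Trace}\,(v\mapsto R_D(u,v)w)$ and $R_D(X,Y)Z=D_XD_YZ-D_YD_XZ-D_{[X,Y]}Z$. Then $\overline{\nabla}$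 is the Levi-Civita connection of $g$, i.e. $\overline{\nabla}_XY=\nabla_XY$ for all vector fields $X,Y$ on $M$. -/

import Mathlib

open Set Bundle VectorField
open scoped Manifold ContDiff Topology

noncomputable section

namespace Spacetime

variable {m : ℕ} {M : Type*} [TopologicalSpace M] [ChartedSpace (EuclideanSpace ℝ (Fin m)) M]
  [IsManifold (𝓡 m) ∞ M]

variable (m M) in
/-- A smooth Lorentzian metric of signature `(-, +, …, +)` on an `m`-dimensional smooth manifold
`M`: a smooth field of symmetric bilinear forms on the tangent spaces such that every tangent space
contains a vector `n` with `⟨n, n⟩ < 0` whose orthogonal complement is positive definite. -/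
structure LorentzMetric where
  /-- The bilinear form `⟨·, ·⟩` on each tangent space. -/
  inner (x : M) : TangentSpace (𝓡 m) x →L[ℝ] TangentSpace (𝓡 m) x →L[ℝ] ℝ
  symm (x : M) (v w : TangentSpace (𝓡 m) x) : inner x v w = inner x w v
  signature (x : M) : ∃ n : TangentSpace (𝓡 m) x, inner x n n < 0 ∧
    ∀ w : TangentSpace (𝓡 m) x, inner x n w = 0 → w ≠ 0 → 0 < inner x w w
  contMDiff : ContMDiff (𝓡 m)
    ((𝓡 m).prod 𝓘(ℝ, EuclideanSpace ℝ (Fin m) →L[ℝ] EuclideanSpace ℝ (Fin m) →L[ℝ] ℝ)) ∞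
    (fun x ↦ TotalSpace.mk'
      (EuclideanSpace ℝ (Fin m) →L[ℝ] EuclideanSpace ℝ (Fin m) →L[ℝ] ℝ) x (inner x))

variable (m M) in
/-- Vector fields on `M`, without any regularity. -/
abbrev VField : Type _ := Π x : M, TangentSpace (𝓡 m) x

/-- The vector field `X` is differentiable at `x`. -/
abbrev VField.DiffAt (X : VField m M) (x : M) : Prop :=
  MDifferentiableAt (𝓡 m) ((𝓡 m).prod 𝓘(ℝ, EuclideanSpace ℝ (Fin m)))
    (fun y ↦ TotalSpace.mk' (EuclideanSpace ℝ (Fin m)) y (X y)) x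

/-- The derivative of the function `f` in the direction of the tangent vector `v` at `x`. -/
abbrev dirDeriv (f : M → ℝ) (x : M) (v : TangentSpace (𝓡 m) x) : ℝ := mvfderiv (𝓡 m) f x v

variable (m M) in
/-- Connections on (the tangent bundle of) `M`. Following Mathlib's argument order,
`D Y x (X x)` is `(D_X Y)(x)`. -/
abbrev Connection : Type _ :=
  CovariantDerivative (𝓡 m) (EuclideanSpace ℝ (Fin m)) (TangentSpace (𝓡 m) : M → Type _)

/-! ### The Levi-Civita connection -/

/-- `D` is metric for `g`: `v⟨Y, Z⟩ = ⟨D_v Y, Z⟩ + ⟨Y, D_v Z⟩`. -/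
def IsMetricFor (g : LorentzMetric m M) (D : Connection m M) : Prop :=
  ∀ (Y Z : VField m M) (x : M), Y.DiffAt x → Z.DiffAt x → ∀ v : TangentSpace (𝓡 m) x,
    dirDeriv (fun y ↦ g.inner y (Y y) (Z y)) x v
      = g.inner x (D Y x v) (Z x) + g.inner x (Y x) (D Z x v)

namespace LorentzMetric

variable (g : LorentzMetric m M)

/-- The expression for `⟨∇_X Y, Z⟩` given by the Koszul formula,
`½ (X⟨Y,Z⟩ + Y⟨X,Z⟩ - Z⟨X,Y⟩ + ⟨[X,Y],Z⟩ - ⟨[X,Z],Y⟩ - ⟨[Y,Z],X⟩)`, at the point `x`. -/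
def koszul (Y : VField m M) (x : M) (X Z : VField m M) : ℝ :=
  (1 / 2) * (dirDeriv (fun y ↦ g.inner y (Y y) (Z y)) x (X x)
    + dirDeriv (fun y ↦ g.inner y (X y) (Z y)) x (Y x)
    - dirDeriv (fun y ↦ g.inner y (X y) (Y y)) x (Z x)
    + g.inner x (mlieBracket (𝓡 m) X Y x) (Z x)
    - g.inner x (mlieBracket (𝓡 m) X Z x) (Y x)
    - g.inner x (mlieBracket (𝓡 m) Y Z x) (X x))

lemma mdifferentiableAt_inner {Y Z : VField m M} {x : M}
    (hY : Y.DiffAt x) (hZ : Z.DiffAt x) :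
    MDifferentiableAt (𝓡 m) 𝓘(ℝ) (fun y ↦ g.inner y (Y y) (Z y)) x := by
  have : MDifferentiableAt (𝓡 m) ((𝓡 m).prod 𝓘(ℝ)) (fun y ↦ TotalSpace.mk' ℝ
      (E := Bundle.Trivial M ℝ) y (g.inner y (Y y) (Z y))) x := by
    apply MDifferentiableAt.clm_bundle_apply₂ (F₁ := EuclideanSpace ℝ (Fin m))
      (F₂ := EuclideanSpace ℝ (Fin m))
    · exact g.contMDiff.mdifferentiableAt (by simp)
    · exact hY
    · exact hZ
  rw [mdifferentiableAt_totalSpace] at this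
  exact this.2

lemma dirDeriv_add {Y Y' Z : VField m M} {x : M}
    (hY : Y.DiffAt x) (hY' : Y'.DiffAt x) (hZ : Z.DiffAt x) (v : TangentSpace (𝓡 m) x) :
    dirDeriv (fun y ↦ g.inner y ((Y + Y') y) (Z y)) x v
      = dirDeriv (fun y ↦ g.inner y (Y y) (Z y)) x v
        + dirDeriv (fun y ↦ g.inner y (Y' y) (Z y)) x v := by
  have : (fun y ↦ g.inner y ((Y + Y') y) (Z y))
      = (fun y ↦ g.inner y (Y y) (Z y)) + (fun y ↦ g.inner y (Y' y) (Z y)) := by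
    ext y; simp
  simp only [dirDeriv]
  rw [this, mvfderiv_add (g.mdifferentiableAt_inner hY hZ) (g.mdifferentiableAt_inner hY' hZ)]
  rfl

lemma dirDeriv_smul {f : M → ℝ} {Y Z : VField m M} {x : M}
    (hf : MDifferentiableAt (𝓡 m) 𝓘(ℝ) f x) (hY : Y.DiffAt x) (hZ : Z.DiffAt x)
    (v : TangentSpace (𝓡 m) x) :
    dirDeriv (fun y ↦ g.inner y ((f • Y) y) (Z y)) x v
      = f x * dirDeriv (fun y ↦ g.inner y (Y y) (Z y)) x v
        + dirDeriv f x v * g.inner x (Y x) (Z x) := by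
  have : (fun y ↦ g.inner y ((f • Y) y) (Z y)) = f * (fun y ↦ g.inner y (Y y) (Z y)) := by
    ext y; simp
  simp only [dirDeriv]
  rw [this, mvfderiv_mul hf (g.mdifferentiableAt_inner hY hZ)]
  simp [mul_comm]

lemma inner_comm_fun (Y Z : VField m M) :
    (fun y ↦ g.inner y (Y y) (Z y)) = (fun y ↦ g.inner y (Z y) (Y y)) :=
  funext fun y ↦ g.symm y _ _

lemma koszul_tensorial_left {Y Z : VField m M} {x : M} (hY : Y.DiffAt x) (hZ : Z.DiffAt x) :
    TensorialAt (𝓡 m) (EuclideanSpace ℝ (Fin m)) (g.koszul Y x · Z) x where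
  smul {f X} hf hX := by
    simp only [koszul, g.dirDeriv_smul hf hX hZ, g.dirDeriv_smul hf hX hY,
      mlieBracket_smul_left hf hX]
    simp [dirDeriv, g.symm x (X x)]
    ring
  add {X X'} hX hX' := by
    simp only [koszul, g.dirDeriv_add hX hX' hZ, g.dirDeriv_add hX hX' hY,
      mlieBracket_add_left hX hX']
    simp [dirDeriv]
    ring

lemma koszul_tensorial_right {Y X : VField m M} {x : M} (hY : Y.DiffAt x) (hX : X.DiffAt x) :
    TensorialAt (𝓡 m) (EuclideanSpace ℝ (Fin m)) (g.koszul Y x X ·) x where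
  smul {f Z} hf hZ := by
    simp only [koszul, g.inner_comm_fun _ (f • Z), g.dirDeriv_smul hf hZ hX,
      g.dirDeriv_smul hf hZ hY, mlieBracket_smul_right hf hZ, g.inner_comm_fun Z]
    simp [dirDeriv, g.symm x (Z x)]
    ring
  add {Z Z'} hZ hZ' := by
    simp only [koszul, g.inner_comm_fun _ (Z + Z'), g.dirDeriv_add hZ hZ' hX,
      g.dirDeriv_add hZ hZ' hY, mlieBracket_add_right hZ hZ', g.inner_comm_fun Z,
      g.inner_comm_fun Z']
    simp [dirDeriv]
    ring

lemma koszul_add {Y Y' X Z : VField m M} {x : M} (hY : Y.DiffAt x) (hY' : Y'.DiffAt x)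
    (hX : X.DiffAt x) (hZ : Z.DiffAt x) :
    g.koszul (Y + Y') x X Z = g.koszul Y x X Z + g.koszul Y' x X Z := by
  simp only [koszul, g.dirDeriv_add hY hY' hZ, g.inner_comm_fun X, g.dirDeriv_add hY hY' hX,
    mlieBracket_add_left hY hY', mlieBracket_add_right hY hY']
  simp [dirDeriv]
  ring

lemma koszul_smul {f : M → ℝ} {Y X Z : VField m M} {x : M}
    (hf : MDifferentiableAt (𝓡 m) 𝓘(ℝ) f x) (hY : Y.DiffAt x)
    (hX : X.DiffAt x) (hZ : Z.DiffAt x) :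
    g.koszul (f • Y) x X Z
      = f x * g.koszul Y x X Z + dirDeriv f x (X x) * g.inner x (Y x) (Z x) := by
  simp only [koszul, g.dirDeriv_smul hf hY hZ, g.inner_comm_fun X, g.dirDeriv_smul hf hY hX,
    mlieBracket_smul_left hf hY, mlieBracket_smul_right hf hY]
  simp [dirDeriv]
  ring

lemma nondegenerate {x : M} {v : TangentSpace (𝓡 m) x} (h : ∀ w, g.inner x v w = 0) : v = 0 := by
  obtain ⟨n, -, hn⟩ := g.signature x
  by_contra hv
  have := hn v (by rw [g.symm]; exact h n) hv
  simp [h v] at this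

lemma exists_flat (x : M) : ∃ e : TangentSpace (𝓡 m) x ≃ₗ[ℝ] (TangentSpace (𝓡 m) x →L[ℝ] ℝ),
    ∀ v, e v = g.inner x v := by
  have : FiniteDimensional ℝ (TangentSpace (𝓡 m) x) :=
    inferInstanceAs (FiniteDimensional ℝ (EuclideanSpace ℝ (Fin m)))
  have : T2Space (TangentSpace (𝓡 m) x) :=
    inferInstanceAs (T2Space (EuclideanSpace ℝ (Fin m)))
  let c := LinearMap.toContinuousLinearMap (𝕜 := ℝ) (E := TangentSpace (𝓡 m) x) (F' := ℝ)
  have : FiniteDimensional ℝ (TangentSpace (𝓡 m) x →L[ℝ] ℝ) := c.finiteDimensional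
  refine ⟨LinearMap.linearEquivOfInjective (g.inner x : _ →ₗ[ℝ] _) ?_ ?_, fun v ↦ rfl⟩
  · refine (injective_iff_map_eq_zero _).2 fun v hv ↦ g.nondegenerate fun w ↦ ?_
    exact congrArg (fun φ : TangentSpace (𝓡 m) x →L[ℝ] ℝ ↦ φ w) hv
  · rw [← c.finrank_eq]
    exact (Subspace.dual_finrank_eq (K := ℝ) (V := TangentSpace (𝓡 m) x)).symm

/-- The musical isomorphism `v ↦ ⟨v, ·⟩`. -/
def flat (x : M) : TangentSpace (𝓡 m) x ≃ₗ[ℝ] (TangentSpace (𝓡 m) x →L[ℝ] ℝ) :=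
  (g.exists_flat x).choose

lemma flat_apply (x : M) (v : TangentSpace (𝓡 m) x) : g.flat x v = g.inner x v :=
  (g.exists_flat x).choose_spec v

open Classical in
/-- The bilinear form `(v, w) ↦ ⟨∇_v Y, w⟩` on the tangent space at `x`, for a vector field `Y`
that is differentiable at `x` (and zero otherwise). -/
def koszulForm (Y : VField m M) (x : M) :
    TangentSpace (𝓡 m) x →L[ℝ] TangentSpace (𝓡 m) x →L[ℝ] ℝ :=
  if hY : Y.DiffAt x then
    TensorialAt.mkHom₂ (g.koszul Y x) x (fun _ hZ ↦ g.koszul_tensorial_left hY hZ)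
      (fun _ hX ↦ g.koszul_tensorial_right hY hX)
  else 0

lemma koszulForm_apply {Y X Z : VField m M} {x : M} (hY : Y.DiffAt x) (hX : X.DiffAt x)
    (hZ : Z.DiffAt x) : g.koszulForm Y x (X x) (Z x) = g.koszul Y x X Z := by
  rw [koszulForm, dif_pos hY]
  exact TensorialAt.mkHom₂_apply _ _ hX hZ

/-- Two bilinear forms agree if they agree on all differentiable vector fields. -/
lemma ext_field {x : M} {B B' : TangentSpace (𝓡 m) x →L[ℝ] TangentSpace (𝓡 m) x →L[ℝ] ℝ}
    (h : ∀ X Z : VField m M, X.DiffAt x → Z.DiffAt x → B (X x) (Z x) = B' (X x) (Z x)) :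
    B = B' := by
  ext v w
  simpa using h (FiberBundle.extend (EuclideanSpace ℝ (Fin m)) v)
    (FiberBundle.extend (EuclideanSpace ℝ (Fin m)) w)
    (FiberBundle.mdifferentiableAt_extend ..) (FiberBundle.mdifferentiableAt_extend ..)

/-- The field of endomorphisms `v ↦ ∇_v Y`, characterized by `⟨∇_X Y, Z⟩ = koszul Y X Z`. -/
def leviCivitaFun (Y : VField m M) (x : M) :
    TangentSpace (𝓡 m) x →L[ℝ] TangentSpace (𝓡 m) x :=
  haveI : FiniteDimensional ℝ (TangentSpace (𝓡 m) x) :=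
    inferInstanceAs (FiniteDimensional ℝ (EuclideanSpace ℝ (Fin m)))
  haveI : T2Space (TangentSpace (𝓡 m) x) :=
    inferInstanceAs (T2Space (EuclideanSpace ℝ (Fin m)))
  LinearMap.toContinuousLinearMap
    ((g.flat x).symm.toLinearMap ∘ₗ (g.koszulForm Y x : TangentSpace (𝓡 m) x →ₗ[ℝ] _))

lemma inner_leviCivitaFun (Y : VField m M) (x : M) (v w : TangentSpace (𝓡 m) x) :
    g.inner x (g.leviCivitaFun Y x v) w = g.koszulForm Y x v w := by
  rw [← g.flat_apply]
  simp [leviCivitaFun]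

lemma leviCivitaFun_ext {x : M} {A B : TangentSpace (𝓡 m) x →L[ℝ] TangentSpace (𝓡 m) x}
    (h : ∀ X Z : VField m M, X.DiffAt x → Z.DiffAt x →
      g.inner x (A (X x)) (Z x) = g.inner x (B (X x)) (Z x)) : A = B := by
  have : (g.inner x).comp A = (g.inner x).comp B := ext_field fun X Z hX hZ ↦ h X Z hX hZ
  ext1 v
  rw [← sub_eq_zero]
  refine g.nondegenerate fun w ↦ ?_
  have h' := congrArg (fun φ ↦ φ v w) this
  simp only [ContinuousLinearMap.comp_apply] at h'
  simp [h']

/-- The Levi-Civita connection of `g`. -/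
def leviCivita : Connection m M where
  toFun := g.leviCivitaFun
  isCovariantDerivativeOnUniv :=
    { add := by
        intro Y Y' x hY hY' _
        refine g.leviCivitaFun_ext fun X Z hX hZ ↦ ?_
        have hYY : VField.DiffAt (Y + Y') x := mdifferentiableAt_add_section hY hY'
        simp [inner_leviCivitaFun, koszulForm_apply, hY, hY', hYY, hX, hZ, koszul_add]
      leibniz := by
        intro Y f x hY hf _
        refine g.leviCivitaFun_ext fun X Z hX hZ ↦ ?_
        have hfY : VField.DiffAt (f • Y) x := hf.smul_section hY
        simp [inner_leviCivitaFun, koszulForm_apply, hY, hfY, hX, hZ, hf, koszul_smul] }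

lemma inner_leviCivita {Y X Z : VField m M} {x : M} (hY : Y.DiffAt x) (hX : X.DiffAt x)
    (hZ : Z.DiffAt x) :
    g.inner x (g.leviCivita Y x (X x)) (Z x) = g.koszul Y x X Z := by
  rw [← g.koszulForm_apply hY hX hZ]
  exact g.inner_leviCivitaFun ..

/-- The Levi-Civita connection is symmetric. -/
lemma torsion_leviCivita : g.leviCivita.torsion = 0 := by
  rw [CovariantDerivative.torsion_eq_zero_iff]
  intro X Y x hX hY
  rw [← sub_eq_zero]
  refine g.nondegenerate fun w ↦ ?_
  have hw : VField.DiffAt (FiberBundle.extend (EuclideanSpace ℝ (Fin m)) w) x :=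
    FiberBundle.mdifferentiableAt_extend ..
  obtain ⟨Z, hZ, rfl⟩ : ∃ Z : VField m M, Z.DiffAt x ∧ Z x = w := ⟨_, hw, by simp⟩
  simp only [map_sub, sub_apply, g.inner_leviCivita hY hX hZ,
    g.inner_leviCivita hX hY hZ, koszul, g.inner_comm_fun Y X, mlieBracket_swap_apply (V := Y) (W := X)]
  simp
  ring

/-- The Levi-Civita connection is metric. -/
lemma isMetricFor_leviCivita : IsMetricFor g g.leviCivita := by
  intro Y Z x hY hZ v
  obtain ⟨X, hX, rfl⟩ : ∃ X : VField m M, X.DiffAt x ∧ X x = v :=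
    ⟨FiberBundle.extend (EuclideanSpace ℝ (Fin m)) v, FiberBundle.mdifferentiableAt_extend .., by simp⟩
  rw [g.symm x (Y x), g.inner_leviCivita hY hX hZ, g.inner_leviCivita hZ hX hY]
  simp only [koszul, g.inner_comm_fun Z Y, mlieBracket_swap_apply (V := Z) (W := Y)]
  simp
  ring

end LorentzMetric

/-! ### Curvature and Ricci tensor -/

/-- The curvature `R(X, Y)Z = D_X D_Y Z - D_Y D_X Z - D_[X,Y] Z`, at the point `x`. -/
def curvature (D : Connection m M) (X Y Z : VField m M) (x : M) : TangentSpace (𝓡 m) x :=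
  D (fun y ↦ D Z y (Y y)) x (X x) - D (fun y ↦ D Z y (X y)) x (Y x)
    - D Z x (mlieBracket (𝓡 m) X Y x)

/-- The vector field near `x₀` with constant coefficients `w` in the local frame of `TM` given by
the preferred chart at `x₀`. -/
def constField (x₀ : M) (w : EuclideanSpace ℝ (Fin m)) : VField m M :=
  fun y ↦ (trivializationAt (EuclideanSpace ℝ (Fin m)) (TangentSpace (𝓡 m) : M → Type _) x₀).symm
    y w

/-- The vector field `∂ᵢ` near `x₀`. -/
abbrev frameField (x₀ : M) (i : Fin m) : VField m M :=
  constField x₀ (EuclideanSpace.single i 1)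

/-- The coefficients of the tangent vector `v` at `y` in the local frame around `x₀`. -/
def coeffs (x₀ : M) (y : M) (v : TangentSpace (𝓡 m) y) : EuclideanSpace ℝ (Fin m) :=
  (trivializationAt (EuclideanSpace ℝ (Fin m)) (TangentSpace (𝓡 m) : M → Type _) x₀ ⟨y, v⟩).2

/-- The Ricci tensor `Ric(u, w) = Trace(v ↦ R(u, v) w)` at `x`. The curvature tensor is evaluated
on tangent vectors by extending them to the fields with constant coefficients near `x`, and the
trace is computed in the basis `(∂ᵢ)` of the tangent space at `x`. -/
def ricci (D : Connection m M) (x : M) (u w : TangentSpace (𝓡 m) x) : ℝ :=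
  ∑ i : Fin m, coeffs x x
    (curvature D (constField x (coeffs x x u)) (frameField x i) (constField x (coeffs x x w)) x) i

/-! ### Vector fields along curves, parallel transport and geodesics -/

/-- The velocity of the curve `γ` at time `t`. -/
def velocity (γ : ℝ → M) (t : ℝ) : TangentSpace (𝓡 m) (γ t) :=
  mfderiv 𝓘(ℝ, ℝ) (𝓡 m) γ t (1 : ℝ)

/-- The covariant derivative `DV/dt` of a vector field `V` along the curve `γ`. In a local frame
`(∂ᵢ)` around `γ t`, writing `V = ∑ Vⁱ ∂ᵢ`, it is `∑ (Vⁱ)' ∂ᵢ + ∑ Vⁱ D_{γ'} ∂ᵢ`. -/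
def covDerivAlong (D : Connection m M) (γ : ℝ → M) (V : Π t, TangentSpace (𝓡 m) (γ t)) (t : ℝ) :
    TangentSpace (𝓡 m) (γ t) :=
  ∑ i : Fin m, (deriv (fun s ↦ coeffs (γ t) (γ s) (V s) i) t • frameField (γ t) i (γ t)
    + coeffs (γ t) (γ t) (V t) i • D (frameField (γ t) i) (γ t) (velocity γ t))

/-- The vector field `V` along `γ` is (differentiable and) parallel at all times in `s`. -/
def IsParallelOn (D : Connection m M) (γ : ℝ → M) (V : Π t, TangentSpace (𝓡 m) (γ t))
    (s : Set ℝ) : Prop :=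
  ∀ t ∈ s,
    MDifferentiableAt 𝓘(ℝ, ℝ) ((𝓡 m).prod 𝓘(ℝ, EuclideanSpace ℝ (Fin m)))
      (fun t ↦ TotalSpace.mk' (EuclideanSpace ℝ (Fin m)) (E := (TangentSpace (𝓡 m) : M → Type _))
        (γ t) (V t)) t
    ∧ covDerivAlong D γ V t = 0

/-- Parallel transport of `D` along smooth curves maps null vectors of `g` to null vectors. -/
def PreservesLightCones (g : LorentzMetric m M) (D : Connection m M) : Prop :=
  ∀ (a b : ℝ) (γ : ℝ → M) (V : Π t, TangentSpace (𝓡 m) (γ t)),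
    ContMDiffOn 𝓘(ℝ, ℝ) (𝓡 m) ∞ γ (Ioo a b) → IsParallelOn D γ V (Ioo a b) →
    ∀ t₀ ∈ Ioo a b, ∀ t₁ ∈ Ioo a b,
      g.inner (γ t₀) (V t₀) (V t₀) = 0 → g.inner (γ t₁) (V t₁) (V t₁) = 0

/-- `γ : ℝ → M` is a complete geodesic of `D`. -/
def IsCompleteGeodesic (D : Connection m M) (γ : ℝ → M) : Prop :=
  ContMDiff 𝓘(ℝ, ℝ) (𝓡 m) ∞ γ ∧ ∀ t, covDerivAlong D γ (velocity γ) t = 0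

/-- `(M, g)` is viable: it has a complete timelike geodesic. -/
def IsViable (g : LorentzMetric m M) : Prop :=
  ∃ γ : ℝ → M, IsCompleteGeodesic g.leviCivita γ ∧
    ∀ t, g.inner (γ t) (velocity γ t) (velocity γ t) < 0

end Spacetime

end

/-! Write `∇` for the Levi-Civita connection and `A(v, w) = D_v w - ∇_v w`, a symmetric tensor since
both connections are torsion-free. Cone preservation forces `⟨A(v, w), w⟩ = 0` for null `w`
(`inner_diffTensor_eq_zero`). A form vanishing on the cone is proportional to `g`, so polarization
and the permutation argument behind the Koszul formula give the Weyl shape `A(v, w) = ⟨P, v⟩ w + ⟨P,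
w⟩ v - ⟨v, w⟩ P` (`exists_eq_weyl`). It remains to show `P = 0`.

Comparing curvatures and tracing, equality of the Ricci tensors becomes a linear equation for `∇P`.
Its antisymmetric part and its trace, together with `m > 2`, yield `∇_v P = ⟨P, v⟩ P - ½ ⟨P, P⟩ v`
(`IsWeyl.leviCivita_eq`).

Along the complete timelike geodesic put `u = ⟨P, γ'⟩`. Then `u' = u² - ½ ⟨P, P⟩ ⟨γ', γ'⟩ ≥ ½ u²` by
the reverse Cauchy–Schwarz inequality. A solution of this Riccati inequality on all of `ℝ` vanishes,
so `P` is null and orthogonal to a timelike vector, hence zero along `γ` (`eq_zero_along_geodesic`).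
Finally the first-order equation for `P` makes its zero set open (Grönwall, `eventually_eq_zero`),
continuity makes it closed, and `M` is connected. -/

set_option linter.unusedSectionVars false

noncomputable section

namespace Spacetime

variable {m : ℕ} {M : Type*} [TopologicalSpace M] [ChartedSpace (EuclideanSpace ℝ (Fin m)) M]
  [IsManifold (𝓡 m) ∞ M]

local notation "𝔼" => EuclideanSpace ℝ (Fin m)

/-! ### Linear algebra of Lorentzian forms and conformal difference tensors -/

namespace LorentzMetric

variable (g : LorentzMetric m M) {x : M}

/-- The Cauchy–Schwarz inequality on a subspace on which `g` is positive definite. -/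
lemma inner_sq_le_of_pos {s r : TangentSpace (𝓡 m) x}
    (h : ∀ a b : ℝ, 0 ≤ g.inner x (a • s + b • r) (a • s + b • r))
    (hr : 0 < g.inner x r r) :
    g.inner x s r ^ 2 ≤ g.inner x s s * g.inner x r r := by
  -- On `⟨r, r⟩ s - ⟨s, r⟩ r` the form equals `⟨r, r⟩` times the Gram determinant of `s` and `r`.
  have := h (g.inner x r r) (-g.inner x s r)
  simp only [map_add, map_smul, add_apply, smul_apply, smul_eq_mul, g.symm x r s] at this
  nlinarith [this, hr]

/-- The signature axiom supplies one timelike `n` with positive definite complement; this transfers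
the property to every timelike vector. Both vectors are split along `n`, and Cauchy–Schwarz is
applied to the components orthogonal to `n`. -/
lemma pos_of_orthogonal_timelike {τ w : TangentSpace (𝓡 m) x} (hτ : g.inner x τ τ < 0)
    (hw : g.inner x τ w = 0) (hw0 : w ≠ 0) : 0 < g.inner x w w := by
  obtain ⟨n, hn, hpos⟩ := g.signature x
  have hn0 := hn.ne
  have split : ∀ u : TangentSpace (𝓡 m) x, ∃ (a : ℝ) (s : TangentSpace (𝓡 m) x),
      u = a • n + s ∧ g.inner x n s = 0 := fun u ↦
    ⟨g.inner x n u / g.inner x n n, u - (g.inner x n u / g.inner x n n) • n, by abel, by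
      simp only [map_sub, map_smul, smul_eq_mul]; field_simp; ring⟩
  have nonneg : ∀ u : TangentSpace (𝓡 m) x, g.inner x n u = 0 → 0 ≤ g.inner x u u := by
    intro u hu
    by_cases h0 : u = 0
    · simp [h0]
    · exact (hpos u hu h0).le
  obtain ⟨a, s, rfl, hs⟩ := split τ
  obtain ⟨b, r, rfl, hr⟩ := split w
  simp only [map_add, map_smul, add_apply, smul_apply, smul_eq_mul, g.symm x s n, g.symm x r n,
    hs, hr] at hτ hw ⊢
  by_cases hr0 : r = 0
  · subst hr0
    have hsr := nonneg s hs
    have hb : b ≠ 0 := by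
      rintro rfl
      simp at hw0
    simp only [map_zero] at hw
    have : a = 0 := by
      have : a * b * g.inner x n n = 0 := by linear_combination hw
      rcases mul_eq_zero.1 this with h | h
      · exact (mul_eq_zero.1 h).resolve_right hb
      · exact absurd h hn.ne
    subst this
    simp at hτ
    linarith
  · have hrr := hpos r hr hr0
    have cs := g.inner_sq_le_of_pos (s := s) (r := r)
      (fun a b ↦ nonneg _ (by simp [hs, hr])) hrr
    have h1 : g.inner x s r = -(a * b * g.inner x n n) := by linear_combination hw
    have hss := nonneg s hs
    set c := g.inner x n n
    set S := g.inner x s s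
    set R := g.inner x r r
    rw [h1] at cs
    have hS : S < a ^ 2 * (-c) := by nlinarith
    have ha : 0 < a ^ 2 * (-c) := lt_of_le_of_lt hss hS
    -- Orthogonality turns `⟨s, r⟩²` into `(abc)²`, while timelikeness of `τ` bounds `S` strictly by
    -- `a²(-c)`. Cancelling this positive factor leaves `b²(-c) < R`, which is the claim.
    have key : a ^ 2 * (-c) * (b ^ 2 * (-c)) < a ^ 2 * (-c) * R := by
      calc a ^ 2 * (-c) * (b ^ 2 * (-c)) = (-(a * b * c)) ^ 2 := by ring
        _ ≤ S * R := cs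
        _ < a ^ 2 * (-c) * R := by gcongr
    have := lt_of_mul_lt_mul_left key ha.le
    nlinarith

/-- The reverse Cauchy–Schwarz inequality. -/
lemma inner_mul_inner_le_sq {τ : TangentSpace (𝓡 m) x} (hτ : g.inner x τ τ < 0)
    (w : TangentSpace (𝓡 m) x) :
    g.inner x w w * g.inner x τ τ ≤ g.inner x w τ ^ 2 := by
  by_contra! h
  -- A multiple of the projection of `w` to the complement of `τ`; if the inequality failed, `⟨u,
  -- u⟩` would be negative.
  set u := (g.inner x τ τ) • w - (g.inner x w τ) • τ with hu
  have hortho : g.inner x τ u = 0 := by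
    simp only [hu, map_sub, map_smul, smul_eq_mul, g.symm x τ w]; ring
  have huu : g.inner x u u
      = g.inner x τ τ * (g.inner x w w * g.inner x τ τ - g.inner x w τ ^ 2) := by
    simp only [hu, map_sub, map_smul, sub_apply, smul_apply, smul_eq_mul, g.symm x τ w]; ring
  by_cases h0 : u = 0
  · rw [h0] at huu
    simp only [map_zero] at huu
    rcases mul_eq_zero.1 huu.symm with h' | h' <;> linarith
  · have := g.pos_of_orthogonal_timelike hτ hortho h0
    nlinarith

lemma eq_zero_of_orthogonal_timelike {τ w : TangentSpace (𝓡 m) x} (hτ : g.inner x τ τ < 0)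
    (hw : g.inner x w τ = 0) (hww : g.inner x w w = 0) : w = 0 := by
  by_contra h0
  exact (g.pos_of_orthogonal_timelike hτ (by rw [g.symm, hw]) h0).ne' hww

/-- A bilinear form vanishing on the light cone is, on the diagonal, a multiple of the metric. -/
lemma proportional_of_vanish_on_cone {S : TangentSpace (𝓡 m) x →L[ℝ] TangentSpace (𝓡 m) x →L[ℝ] ℝ}
    (hS : ∀ w, g.inner x w w = 0 → S w w = 0) {n : TangentSpace (𝓡 m) x}
    (hn : g.inner x n n < 0) (w : TangentSpace (𝓡 m) x) :
    S w w * g.inner x n n = S n n * g.inner x w w := by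
  have hn0 := hn.ne
  have key : ∀ s, g.inner x n s = 0 →
      S n s + S s n = 0 ∧ S s s * g.inner x n n = S n n * g.inner x s s := by
    intro s hs
    by_cases h0 : s = 0
    · simp [h0]
    have hss := g.pos_of_orthogonal_timelike hn hs h0
    -- With this scaling `a n + s` and `a n - s` are both null. Subtracting the two equations for
    -- `S` kills the mixed term; adding them gives proportionality.
    set a := Real.sqrt (g.inner x s s / -g.inner x n n) with ha
    have hpos : 0 < g.inner x s s / -g.inner x n n := div_pos hss (by linarith)
    have ha0 : 0 < a := Real.sqrt_pos.2 hpos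
    have ha2 : a ^ 2 * g.inner x n n = - g.inner x s s := by
      rw [ha, Real.sq_sqrt hpos.le]
      field_simp
    have h1 := hS (a • n + s) (by
      simp only [map_add, map_smul, add_apply, smul_apply, smul_eq_mul, g.symm x s n, hs]
      linear_combination ha2)
    have h2 := hS (a • n - s) (by
      simp only [map_sub, map_smul, sub_apply, smul_apply, smul_eq_mul, g.symm x s n, hs]
      linear_combination ha2)
    simp only [map_add, map_sub, map_smul, add_apply, sub_apply, smul_apply, smul_eq_mul] at h1 h2
    constructor
    · have : a * (S n s + S s n) = 0 := by linear_combination (h1 - h2) / 2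
      exact (mul_eq_zero.1 this).resolve_left ha0.ne'
    · linear_combination g.inner x n n * (h1 + h2) / 2 - S n n * ha2
  set c := g.inner x n w / g.inner x n n with hc
  obtain ⟨s, hs, hns⟩ : ∃ s, w = c • n + s ∧ g.inner x n s = 0 := ⟨w - c • n, by abel, by
      simp only [hc, map_sub, map_smul, smul_eq_mul]; field_simp; ring⟩
  obtain ⟨h1, h2⟩ := key s hns
  rw [hs]
  simp only [map_add, map_smul, add_apply, smul_apply, smul_eq_mul, g.symm x s n, hns]
  linear_combination c * g.inner x n n * h1 + h2

/-- A symmetric difference tensor that is conformal for `g` has the shape it has for Weyl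
connections. -/
lemma exists_eq_weyl {A : TangentSpace (𝓡 m) x →L[ℝ] TangentSpace (𝓡 m) x →L[ℝ] TangentSpace (𝓡 m) x}
    (hA : ∀ v w, A v w = A w v)
    (hcone : ∀ v w, g.inner x w w = 0 → g.inner x (A v w) w = 0) :
    ∃ P : TangentSpace (𝓡 m) x, ∀ v w,
      A v w = g.inner x P v • w + g.inner x P w • v - g.inner x v w • P := by
  obtain ⟨n, hn, -⟩ := g.signature x
  have hn0 := hn.ne
  obtain ⟨P, hP⟩ : ∃ P : TangentSpace (𝓡 m) x, ∀ v, g.inner x P v * g.inner x n n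
      = g.inner x (A v n) n := by
    -- The factor in `⟨A(v, w), w⟩ = φ(v) ⟨w, w⟩` is read off at `w = n`, and `P` is the vector dual
    -- to `φ`.
    refine ⟨(g.flat x).symm ((g.inner x n n)⁻¹ • (g.inner x n).comp (A n)), fun v ↦ ?_⟩
    rw [← g.flat_apply, LinearEquiv.apply_symm_apply, smul_apply, ContinuousLinearMap.comp_apply,
      hA n v, smul_eq_mul, g.symm x n (A v n)]
    field_simp
  refine ⟨P, fun v w ↦ ?_⟩
  have diag : ∀ v w, g.inner x (A v w) w = g.inner x P v * g.inner x w w := by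
    intro v w
    have := g.proportional_of_vanish_on_cone (S := (g.inner x).comp (A v)) (hcone v) hn w
    simp only [ContinuousLinearMap.comp_apply] at this
    have h := hP v
    apply mul_right_cancel₀ hn.ne
    linear_combination this - h * g.inner x w w
  have polar : ∀ v y z, g.inner x (A v y) z + g.inner x (A v z) y
      = 2 * (g.inner x P v * g.inner x y z) := by
    intro v y z
    have h := diag v (y + z)
    simp only [map_add, add_apply, g.symm x z y] at h
    linear_combination h - diag v y - diag v z
  rw [← sub_eq_zero]
  refine g.nondegenerate fun z ↦ ?_
  simp only [map_sub, map_add, map_smul, add_apply, sub_apply, smul_apply, smul_eq_mul]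
  -- As for the Christoffel symbols: cyclic permutation and symmetry of `A` isolate `⟨A(v, w), z⟩`.
  have h1 := polar v w z
  have h2 := polar w v z
  have h3 := polar z v w
  rw [hA w v, hA w z] at h2
  rw [hA z v] at h3
  linear_combination (h1 + h2 - h3) / 2

end LorentzMetric

/-! ### Coordinate frames and coefficients -/

/-- The vector field `X` is smooth at `x`. -/
abbrev VField.SmoothAt (X : VField m M) (x : M) : Prop :=
  ContMDiffAt (𝓡 m) ((𝓡 m).prod 𝓘(ℝ, 𝔼)) ∞ (fun y ↦ TotalSpace.mk' 𝔼 y (X y)) x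

lemma VField.SmoothAt.diffAt {X : VField m M} {x : M} (h : X.SmoothAt x) : X.DiffAt x :=
  h.mdifferentiableAt (by simp)

section Frames

variable {x₀ y : M}

lemma mem_baseSet (hy : y ∈ (chartAt 𝔼 x₀).source) :
    y ∈ (trivializationAt 𝔼 (TangentSpace (𝓡 m) : M → Type _) x₀).baseSet := hy

lemma constField_eq_symmL (hy : y ∈ (chartAt 𝔼 x₀).source) (w : 𝔼) : constField x₀ w y
    = (trivializationAt 𝔼 (TangentSpace (𝓡 m) : M → Type _) x₀).symmL ℝ y w :=
  (Trivialization.symmL_apply _ (mem_baseSet hy) w).symm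

lemma coeffs_eq_clm (hy : y ∈ (chartAt 𝔼 x₀).source) (v : TangentSpace (𝓡 m) y) :
    coeffs x₀ y v
      = (trivializationAt 𝔼 (TangentSpace (𝓡 m) : M → Type _) x₀).continuousLinearMapAt ℝ y v := by
  rw [Trivialization.continuousLinearMapAt_apply,
    Trivialization.coe_linearMapAt_of_mem _ (mem_baseSet hy)]
  rfl

lemma coeffs_constField (hy : y ∈ (chartAt 𝔼 x₀).source) (w : 𝔼) :
    coeffs x₀ y (constField x₀ w y) = w := by
  rw [coeffs_eq_clm hy, constField_eq_symmL hy, Trivialization.continuousLinearMapAt_symmL _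
    (mem_baseSet hy)]

lemma constField_coeffs (hy : y ∈ (chartAt 𝔼 x₀).source) (v : TangentSpace (𝓡 m) y) :
    constField x₀ (coeffs x₀ y v) y = v := by
  rw [coeffs_eq_clm hy, constField_eq_symmL hy, Trivialization.symmL_continuousLinearMapAt _
    (mem_baseSet hy)]

lemma constField_eq_sum (hy : y ∈ (chartAt 𝔼 x₀).source) (w : 𝔼) : constField x₀ w y = ∑ i, w i • frameField x₀ i y := by
  have : w = ∑ i, w i • EuclideanSpace.single i (1 : ℝ) := by
    ext j
    simp [Finset.sum_apply, Pi.single_apply]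
  conv_lhs => rw [this]
  simp only [constField_eq_symmL hy, map_sum, map_smul]

lemma sum_coeffs (hy : y ∈ (chartAt 𝔼 x₀).source) (v : TangentSpace (𝓡 m) y) :
    ∑ i, coeffs x₀ y v i • frameField x₀ i y = v := by
  rw [← constField_eq_sum hy, constField_coeffs hy]

/-- The coefficients of tangent vectors at a point, as a linear map. -/
def coeffsL (x₀ y : M) : TangentSpace (𝓡 m) y →L[ℝ] 𝔼 :=
  (trivializationAt 𝔼 (TangentSpace (𝓡 m) : M → Type _) x₀).continuousLinearMapAt ℝ y

lemma coeffsL_apply (hy : y ∈ (chartAt 𝔼 x₀).source) (v : TangentSpace (𝓡 m) y) :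
    coeffsL x₀ y v = coeffs x₀ y v := (coeffs_eq_clm hy v).symm

lemma smoothAt_iff_coeffs (hy : y ∈ (chartAt 𝔼 x₀).source) {X : VField m M} :
    X.SmoothAt y ↔ ContMDiffAt (𝓡 m) 𝓘(ℝ, 𝔼) ∞ (fun z ↦ coeffs x₀ z (X z)) y :=
  (trivializationAt 𝔼 (TangentSpace (𝓡 m) : M → Type _) x₀).contMDiffAt_section_iff (mem_baseSet hy)

lemma diffAt_iff_coeffs (hy : y ∈ (chartAt 𝔼 x₀).source) {X : VField m M} :
    X.DiffAt y ↔ MDifferentiableAt (𝓡 m) 𝓘(ℝ, 𝔼) (fun z ↦ coeffs x₀ z (X z)) y :=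
  (trivializationAt 𝔼 (TangentSpace (𝓡 m) : M → Type _) x₀).mdifferentiableAt_section_iff
    (𝓡 m) X (mem_baseSet hy)

lemma source_mem_nhds (hy : y ∈ (chartAt 𝔼 x₀).source) : (chartAt 𝔼 x₀).source ∈ 𝓝 y :=
  (chartAt 𝔼 x₀).open_source.mem_nhds hy

lemma smoothAt_constField (hy : y ∈ (chartAt 𝔼 x₀).source) (w : 𝔼) :
    VField.SmoothAt (constField x₀ w : VField m M) y := by
  rw [smoothAt_iff_coeffs hy]
  refine (contMDiffAt_const (c := w)).congr_of_eventuallyEq ?_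
  filter_upwards [source_mem_nhds hy] with z hz
  exact coeffs_constField hz w

lemma diffAt_constField (hy : y ∈ (chartAt 𝔼 x₀).source) (w : 𝔼) :
    VField.DiffAt (constField x₀ w : VField m M) y :=
  (smoothAt_constField hy w).diffAt

lemma mdifferentiableAt_sum {ι F : Type*} [NormedAddCommGroup F] [NormedSpace ℝ F] (s : Finset ι)
    {f : ι → M → F} (hf : ∀ i, MDifferentiableAt (𝓡 m) 𝓘(ℝ, F) (f i) y) :
    MDifferentiableAt (𝓡 m) 𝓘(ℝ, F) (fun z ↦ ∑ i ∈ s, f i z) y := by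
  classical
  induction s using Finset.induction_on with
  | empty => simpa using mdifferentiableAt_const
  | insert i s hi ih =>
    simp only [Finset.sum_insert hi]
    exact (hf i).add ih

lemma mdifferentiableAt_euclidean_iff {f : M → 𝔼} :
    MDifferentiableAt (𝓡 m) 𝓘(ℝ, 𝔼) f y
      ↔ ∀ i, MDifferentiableAt (𝓡 m) 𝓘(ℝ) (fun z ↦ f z i) y := by
  constructor
  · intro h i
    exact ((EuclideanSpace.proj (𝕜 := ℝ) i : 𝔼 →L[ℝ] ℝ).mdifferentiableAt).comp y h
  · intro h
    have hf : f = fun z ↦ ∑ i, f z i • EuclideanSpace.single i (1 : ℝ) := by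
      ext z j
      simp [Finset.sum_apply, Pi.single_apply]
    rw [hf]
    exact mdifferentiableAt_sum _ fun i ↦ (h i).smul mdifferentiableAt_const

end Frames

/-! ### Local rules of calculus for a connection -/

section Local

variable {x₀ y : M}

lemma connection_congr (D : Connection m M) {X Y : VField m M} (hX : X.DiffAt y)
    (h : ∀ᶠ z in 𝓝 y, X z = Y z) : D X y = D Y y := by
  have hY : Y.DiffAt y := hX.congr_of_eventuallyEq (by
    filter_upwards [h] with z hz
    rw [hz])
  exact IsCovariantDerivativeOn.congr_of_eventuallyEq D.isCovariantDerivativeOnUniv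
    hX hY Filter.univ_mem h

lemma VField.DiffAt.congr {X Y : VField m M} (hX : X.DiffAt y)
    (h : ∀ᶠ z in 𝓝 y, X z = Y z) : Y.DiffAt y :=
  hX.congr_of_eventuallyEq (by
    filter_upwards [h] with z hz
    rw [hz])

lemma VField.DiffAt.add {X Y : VField m M} (hX : X.DiffAt y) (hY : Y.DiffAt y) :
    VField.DiffAt (X + Y) y := mdifferentiableAt_add_section hX hY

lemma VField.DiffAt.sub {X Y : VField m M} (hX : X.DiffAt y) (hY : Y.DiffAt y) :
    VField.DiffAt (X - Y) y := mdifferentiableAt_sub_section hX hY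

lemma VField.DiffAt.smul {f : M → ℝ} {X : VField m M} (hf : MDifferentiableAt (𝓡 m) 𝓘(ℝ) f y)
    (hX : X.DiffAt y) : VField.DiffAt (f • X) y := hf.smul_section hX

lemma connection_add (D : Connection m M) {X Y : VField m M} (hX : X.DiffAt y) (hY : Y.DiffAt y) :
    D (X + Y) y = D X y + D Y y := D.isCovariantDerivativeOnUniv.add hX hY

lemma connection_smul (D : Connection m M) {f : M → ℝ} {X : VField m M}
    (hf : MDifferentiableAt (𝓡 m) 𝓘(ℝ) f y) (hX : X.DiffAt y) (v : TangentSpace (𝓡 m) y) :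
    D (f • X) y v = f y • D X y v + dirDeriv f y v • X y := by
  rw [D.isCovariantDerivativeOnUniv.leibniz hX hf]
  simp [dirDeriv]

lemma connection_sub (D : Connection m M) {X Y : VField m M} (hX : X.DiffAt y) (hY : Y.DiffAt y) :
    D (X - Y) y = D X y - D Y y := by
  have := connection_add D (hX.sub hY) hY
  rw [sub_add_cancel] at this
  rw [this, add_sub_cancel_right]

lemma connection_sum (D : Connection m M) {ι : Type*} (s : Finset ι) {X : ι → VField m M}
    (hX : ∀ i, (X i).DiffAt y) :
    VField.DiffAt (∑ i ∈ s, X i) y ∧ D (∑ i ∈ s, X i) y = ∑ i ∈ s, D (X i) y := by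
  classical
  induction s using Finset.induction_on with
  | empty =>
    refine ⟨?_, by simp⟩
    rw [Finset.sum_empty]
    exact mdifferentiableAt_zeroSection ..
  | insert i s hi ih =>
    rw [Finset.sum_insert hi, Finset.sum_insert hi]
    exact ⟨(hX i).add ih.1, by rw [connection_add D (hX i) ih.1, ih.2]⟩

/-- The covariant derivative in terms of the coefficients in a local frame. -/
lemma connection_eq_sum (D : Connection m M) (hy : y ∈ (chartAt 𝔼 x₀).source) {X : VField m M}
    (hX : X.DiffAt y) (v : TangentSpace (𝓡 m) y) :
    D X y v = ∑ i, (dirDeriv (fun z ↦ coeffs x₀ z (X z) i) y v • frameField x₀ i y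
      + coeffs x₀ y (X y) i • D (frameField x₀ i) y v) := by
  have hc := mdifferentiableAt_euclidean_iff.1 ((diffAt_iff_coeffs hy).1 hX)
  have hF : ∀ i, VField.DiffAt ((fun z ↦ coeffs x₀ z (X z) i) • frameField x₀ i) y :=
    fun i ↦ (diffAt_constField hy _).smul (hc i)
  rw [connection_congr D hX (Y := ∑ i, (fun z ↦ coeffs x₀ z (X z) i) • frameField x₀ i),
    (connection_sum D _ hF).2]
  · rw [sum_apply]
    refine Finset.sum_congr rfl fun i _ ↦ ?_
    rw [connection_smul D (hc i) (diffAt_constField hy _), add_comm]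
  · filter_upwards [source_mem_nhds hy] with z hz
    simp only [Finset.sum_apply, Pi.smul_apply']
    exact (sum_coeffs hz _).symm

end Local

/-! ### Smoothness of derived fields and functions -/

section Smoothness

variable {y : M}

/-- Smoothness of `D` is applied to globally smooth fields, whereas coordinate fields are smooth
only near a point. A bump function bridges the gap. -/
lemma exists_contMDiff_eventuallyEq [T2Space M] {X : VField m M}
    (hX : ∀ᶠ z in 𝓝 y, X.SmoothAt z) :
    ∃ X' : VField m M, (∀ z, X'.SmoothAt z) ∧ ∀ᶠ z in 𝓝 y, X' z = X z := by
  obtain ⟨f, -, hf⟩ := (SmoothBumpFunction.nhds_basis_tsupport (I := 𝓡 m) y).mem_iff.1 hX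
  refine ⟨fun z ↦ f z • X z, fun z ↦ ?_, ?_⟩
  · by_cases hz : z ∈ tsupport f
    · exact ContMDiffAt.smul_section f.contMDiffAt (hf hz)
    · refine (contMDiff_zeroSection ℝ (TangentSpace (𝓡 m) : M → Type _)
        (n := ∞) (IB := 𝓡 m) (F := 𝔼)).contMDiffAt.congr_of_eventuallyEq ?_
      filter_upwards [(isClosed_tsupport f).isOpen_compl.mem_nhds hz] with z' hz'
      rw [image_eq_zero_of_notMem_tsupport hz', zero_smul]
      rfl
  · filter_upwards [f.eventuallyEq_one] with z hz
    rw [hz, Pi.one_apply, one_smul]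

lemma smoothAt_connection [T2Space M] {D : Connection m M}
    (hD : D.ContMDiffCovariantDerivative ∞) {X Y : VField m M}
    (hX : ∀ᶠ z in 𝓝 y, X.SmoothAt z) (hY : Y.SmoothAt y) :
    VField.SmoothAt (fun z ↦ D X z (Y z)) y := by
  obtain ⟨X', hX', hXX'⟩ := exists_contMDiff_eventuallyEq hX
  have h1 := hD.contMDiff.contMDiff (σ := X') (fun z _ ↦ (hX' z).contMDiffWithinAt)
  have h2 := (h1 y (mem_univ y)).contMDiffAt Filter.univ_mem
  refine (ContMDiffAt.clm_bundle_apply h2 hY).congr_of_eventuallyEq ?_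
  filter_upwards [hXX'.eventually_nhds] with z hz
  rw [connection_congr D (hX' z).diffAt hz]

lemma LorentzMetric.contMDiffAt_inner (g : LorentzMetric m M) {Y Z : VField m M}
    (hY : Y.SmoothAt y) (hZ : Z.SmoothAt y) :
    ContMDiffAt (𝓡 m) 𝓘(ℝ) ∞ (fun z ↦ g.inner z (Y z) (Z z)) y := by
  have : ContMDiffAt (𝓡 m) ((𝓡 m).prod 𝓘(ℝ)) ∞ (fun z ↦ TotalSpace.mk' ℝ
      (E := Bundle.Trivial M ℝ) z (g.inner z (Y z) (Z z))) y := by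
    apply ContMDiffAt.clm_bundle_apply₂ (F₁ := EuclideanSpace ℝ (Fin m))
      (F₂ := EuclideanSpace ℝ (Fin m))
    · exact g.contMDiff.contMDiffAt
    · exact hY
    · exact hZ
  rw [contMDiffAt_totalSpace] at this
  exact this.2

lemma contMDiffAt_dirDeriv {f : M → ℝ} (hf : ContMDiffAt (𝓡 m) 𝓘(ℝ) ∞ f y) {X : VField m M}
    (hX : X.SmoothAt y) : ContMDiffAt (𝓡 m) 𝓘(ℝ) ∞ (fun z ↦ dirDeriv f z (X z)) y := by
  have h1 := hf.mfderiv_const (m := ∞) (by simp)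
  have h2 := ContMDiffAt.clm_apply_of_inCoordinates (b₁ := id) (b₂ := f) (v := X)
    (E₁ := (TangentSpace (𝓡 m) : M → Type _)) (E₂ := (TangentSpace 𝓘(ℝ) : ℝ → Type _))
    (ϕ := fun z ↦ mfderiv (𝓡 m) 𝓘(ℝ) f z) h1 hX hf
  have h3 := (contMDiffAt_totalSpace.1 h2).2
  simp only [trivializationAt_model_space_apply] at h3
  exact h3

end Smoothness

/-! ### Derivatives along curves and straight lines in a chart -/

section Curves

variable {γ : ℝ → M} {t : ℝ}

lemma hasDerivAt_comp_curve {f : M → ℝ} (hf : MDifferentiableAt (𝓡 m) 𝓘(ℝ) f (γ t))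
    (hγ : MDifferentiableAt 𝓘(ℝ) (𝓡 m) γ t) :
    HasDerivAt (fun s ↦ f (γ s)) (dirDeriv f (γ t) (velocity (m := m) γ t)) t := by
  have h1 : HasMFDerivAt 𝓘(ℝ) 𝓘(ℝ) (f ∘ γ) t _ := hf.hasMFDerivAt.comp t hγ.hasMFDerivAt
  have key : ∀ L : ℝ →L[ℝ] ℝ, HasMFDerivAt 𝓘(ℝ) 𝓘(ℝ) (fun s ↦ f (γ s)) t L →
      HasDerivAt (fun s ↦ f (γ s)) (L 1) t := fun L h ↦ by
    have h' : HasFDerivAt (fun s ↦ f (γ s)) L t := h.hasFDerivAt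
    exact h'.hasDerivAt
  exact key _ h1

lemma eventually_mem_source (hγ : MDifferentiableAt 𝓘(ℝ) (𝓡 m) γ t) {x₀ : M}
    (h : γ t ∈ (chartAt 𝔼 x₀).source) : ∀ᶠ s in 𝓝 t, γ s ∈ (chartAt 𝔼 x₀).source :=
  hγ.continuousAt.eventually_mem (source_mem_nhds h)

/-- Both sides have the same frame expansion, by the chain rule for the coefficients. Parallelism
along a curve can thus be tested on an ambient field. -/
lemma covDerivAlong_comp (D : Connection m M) (hγ : MDifferentiableAt 𝓘(ℝ) (𝓡 m) γ t)
    {Y : VField m M} (hY : Y.DiffAt (γ t)) :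
    covDerivAlong D γ (fun s ↦ Y (γ s)) t = D Y (γ t) (velocity γ t) := by
  have hy : γ t ∈ (chartAt 𝔼 (γ t)).source := mem_chart_source _ _
  rw [connection_eq_sum D hy hY, covDerivAlong]
  refine Finset.sum_congr rfl fun i _ ↦ ?_
  congr 2
  exact (hasDerivAt_comp_curve
    (mdifferentiableAt_euclidean_iff.1 ((diffAt_iff_coeffs hy).1 hY) i) hγ).deriv

lemma mdifferentiableAt_along_iff {V : Π t, TangentSpace (𝓡 m) (γ t)} {x₀ : M}
    (h : γ t ∈ (chartAt 𝔼 x₀).source) :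
    MDifferentiableAt 𝓘(ℝ) ((𝓡 m).prod 𝓘(ℝ, 𝔼)) (fun s ↦ TotalSpace.mk' 𝔼
      (E := (TangentSpace (𝓡 m) : M → Type _)) (γ s) (V s)) t ↔
    MDifferentiableAt 𝓘(ℝ) (𝓡 m) γ t ∧ DifferentiableAt ℝ (fun s ↦ coeffs x₀ (γ s) (V s)) t := by
  rw [(trivializationAt 𝔼 (TangentSpace (𝓡 m) : M → Type _) x₀).mdifferentiableAt_totalSpace_iff
    (𝓡 m) _ (by rw [Trivialization.mem_source]; exact h), ← mdifferentiableAt_iff_differentiableAt]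
  rfl

/-- The product rule for the inner product of a vector field with a vector field along a curve. -/
lemma LorentzMetric.hasDerivAt_inner_along (g : LorentzMetric m M)
    {V : Π t, TangentSpace (𝓡 m) (γ t)}
    (hV : MDifferentiableAt 𝓘(ℝ) ((𝓡 m).prod 𝓘(ℝ, 𝔼)) (fun s ↦ TotalSpace.mk' 𝔼
      (E := (TangentSpace (𝓡 m) : M → Type _)) (γ s) (V s)) t)
    {P : VField m M} (hP : P.DiffAt (γ t)) :
    HasDerivAt (fun s ↦ g.inner (γ s) (P (γ s)) (V s))
      (g.inner (γ t) (g.leviCivita P (γ t) (velocity γ t)) (V t)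
        + g.inner (γ t) (P (γ t)) (covDerivAlong g.leviCivita γ V t)) t := by
  have hy : γ t ∈ (chartAt 𝔼 (γ t)).source := mem_chart_source _ _
  obtain ⟨hγ, hc⟩ := (mdifferentiableAt_along_iff hy).1 hV
  have hF : ∀ i, VField.DiffAt (frameField (γ t) i) (γ t) := fun i ↦ diffAt_constField hy _
  have hci : ∀ i, HasDerivAt (fun s ↦ coeffs (γ t) (γ s) (V s) i)
      (deriv (fun s ↦ coeffs (γ t) (γ s) (V s) i) t) t := fun i ↦
    ((EuclideanSpace.proj (𝕜 := ℝ) i : 𝔼 →L[ℝ] ℝ).differentiableAt.comp t hc).hasDerivAt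
  have hsum : HasDerivAt (fun s ↦ ∑ i, coeffs (γ t) (γ s) (V s) i *
      g.inner (γ s) (P (γ s)) (frameField (γ t) i (γ s))) _ t :=
    HasDerivAt.fun_sum fun i _ ↦ (hci i).mul
      (hasDerivAt_comp_curve (g.mdifferentiableAt_inner hP (hF i)) hγ)
  refine (hsum.congr_of_eventuallyEq ?_).congr_deriv ?_
  · filter_upwards [eventually_mem_source hγ hy] with s hs
    conv_lhs => rw [← sum_coeffs hs (V s)]
    simp only [map_sum, map_smul, smul_eq_mul]
  · conv_rhs => rw [← sum_coeffs hy (V t)]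
    rw [covDerivAlong]
    simp only [map_sum, map_add, map_smul, smul_eq_mul, ← Finset.sum_add_distrib]
    refine Finset.sum_congr rfl fun i _ ↦ ?_
    rw [g.isMetricFor_leviCivita P (frameField (γ t) i) (γ t) hP (hF i)]
    ring

/-- The curve which is a straight line in the chart around `x₀`. -/
def chartLine (x₀ : M) (p v : 𝔼) (t : ℝ) : M := (extChartAt (𝓡 m) x₀).symm (p + t • v)

variable {x₀ : M} {p v : EuclideanSpace ℝ (Fin m)}

lemma chartLine_mem (h : p + t • v ∈ (extChartAt (𝓡 m) x₀).target) :
    chartLine x₀ p v t ∈ (chartAt 𝔼 x₀).source := by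
  rw [← extChartAt_source (𝓡 m)]
  exact (extChartAt (𝓡 m) x₀).map_target h

lemma extChartAt_chartLine (h : p + t • v ∈ (extChartAt (𝓡 m) x₀).target) :
    extChartAt (𝓡 m) x₀ (chartLine x₀ p v t) = p + t • v :=
  (extChartAt (𝓡 m) x₀).right_inv h

lemma contMDiffAt_extChartAt_symm_of_mem {q : 𝔼} (h : q ∈ (extChartAt (𝓡 m) x₀).target) :
    ContMDiffAt 𝓘(ℝ, 𝔼) (𝓡 m) ∞ (extChartAt (𝓡 m) x₀).symm q :=
  (contMDiffOn_extChartAt_symm x₀ q h).contMDiffAt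
    ((isOpen_extChartAt_target x₀).mem_nhds h)

lemma contMDiffAt_chartLine (h : p + t • v ∈ (extChartAt (𝓡 m) x₀).target) :
    ContMDiffAt 𝓘(ℝ) (𝓡 m) ∞ (chartLine x₀ p v) t := by
  refine (contMDiffAt_extChartAt_symm_of_mem h).comp t (f := fun t : ℝ ↦ p + t • v) ?_
  rw [contMDiffAt_iff_contDiffAt]
  fun_prop

lemma velocity_chartLine (h : p + t • v ∈ (extChartAt (𝓡 m) x₀).target) :
    velocity (chartLine x₀ p v) t = constField x₀ v (chartLine x₀ p v t) := by
  have hs := chartLine_mem h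
  have h1 : HasMFDerivAt 𝓘(ℝ) 𝓘(ℝ, 𝔼) (fun t : ℝ ↦ p + t • v) t
      (ContinuousLinearMap.toSpanSingleton ℝ v) := by
    apply HasFDerivAt.hasMFDerivAt
    have : HasDerivAt (fun t : ℝ ↦ p + t • v) v t := by
      simpa using ((hasDerivAt_id t).smul_const v).const_add p
    exact this.hasFDerivAt
  have h2 := ((contMDiffAt_extChartAt_symm_of_mem h).mdifferentiableAt (by simp)).hasMFDerivAt
  have h3 : HasMFDerivAt 𝓘(ℝ) (𝓡 m) (chartLine x₀ p v) t _ := h2.comp t h1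
  rw [velocity, h3.mfderiv, constField_eq_symmL hs, TangentBundle.symmL_trivializationAt hs,
    extChartAt_chartLine h]
  simp only [modelWithCornersSelf_coe, range_id, mfderivWithin_univ]
  exact congrArg (mfderiv 𝓘(ℝ, 𝔼) (𝓡 m) (extChartAt (𝓡 m) x₀).symm (p + t • v)) (one_smul ℝ v)

end Curves

/-! ### The difference tensor and the Weyl form of cone-preserving connections -/

/-- The difference of two connections: `diffTensor D D' x (Y x) v = D_v Y - D'_v Y`. -/
def diffTensor (D D' : Connection m M) (x : M) :
    TangentSpace (𝓡 m) x →L[ℝ] TangentSpace (𝓡 m) x →L[ℝ] TangentSpace (𝓡 m) x :=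
  IsCovariantDerivativeOn.difference D.isCovariantDerivativeOnUniv D'.isCovariantDerivativeOnUniv x

lemma diffTensor_apply (D D' : Connection m M) {x : M} {Y : VField m M} (hY : Y.DiffAt x)
    (v : TangentSpace (𝓡 m) x) : diffTensor D D' x (Y x) v = D Y x v - D' Y x v := by
  rw [diffTensor, IsCovariantDerivativeOn.difference_apply _ _ (mem_univ x) hY]
  rfl

lemma exists_diffAt_eq {x : M} (v : TangentSpace (𝓡 m) x) :
    ∃ Y : VField m M, Y.DiffAt x ∧ Y x = v :=
  ⟨constField x (coeffs x x v), diffAt_constField (mem_chart_source _ x) _,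
    constField_coeffs (mem_chart_source _ x) v⟩

lemma diffTensor_symm {D D' : Connection m M} (hD : D.torsion = 0) (hD' : D'.torsion = 0) {x : M}
    (v w : TangentSpace (𝓡 m) x) : diffTensor D D' x v w = diffTensor D D' x w v := by
  obtain ⟨X, hX, rfl⟩ := exists_diffAt_eq v
  obtain ⟨Y, hY, rfl⟩ := exists_diffAt_eq w
  rw [CovariantDerivative.torsion_eq_zero_iff] at hD hD'
  rw [diffTensor_apply D D' hX, diffTensor_apply D D' hY]
  have h1 := hD hX hY
  have h2 := hD' hX hY
  rw [sub_eq_sub_iff_sub_eq_sub]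
  rw [← neg_inj, neg_sub, neg_sub, h1, h2]

/-- Any tangent vector can be extended to a vector field which is parallel along a straight line
in a chart. -/
lemma exists_parallel_field [T2Space M] {D : Connection m M}
    (hD : D.ContMDiffCovariantDerivative ∞) {x₀ : M} {v : 𝔼} (hv : v ≠ 0) (w : 𝔼) :
    ∃ (Y : VField m M) (δ : ℝ), 0 < δ ∧ Y x₀ = constField x₀ w x₀ ∧ ∀ t ∈ Ioo (-δ) δ,
      extChartAt (𝓡 m) x₀ x₀ + t • v ∈ (extChartAt (𝓡 m) x₀).target ∧
      Y.DiffAt (chartLine x₀ (extChartAt (𝓡 m) x₀ x₀) v t) ∧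
      D Y (chartLine x₀ (extChartAt (𝓡 m) x₀ x₀) v t)
        (velocity (chartLine x₀ (extChartAt (𝓡 m) x₀ x₀) v) t) = 0 := by
  set p := extChartAt (𝓡 m) x₀ x₀ with hp
  set c := chartLine x₀ p v with hc
  have hp0 : p + (0 : ℝ) • v ∈ (extChartAt (𝓡 m) x₀).target := by
    simp [hp]
  have hc0 : c 0 = x₀ := by simp [hc, chartLine, hp]
  let Γ : Fin m → ℝ → 𝔼 := fun i t ↦
    coeffs x₀ (c t) (D (frameField x₀ i) (c t) (constField x₀ v (c t)))
  have hx₀ : x₀ ∈ (chartAt 𝔼 x₀).source := mem_chart_source _ x₀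
  have hΓ : ∀ i, ContDiffAt ℝ 1 (Γ i) 0 := by
    intro i
    have h1 : VField.SmoothAt (fun z ↦ D (frameField x₀ i) z (constField x₀ v z)) x₀ :=
      smoothAt_connection hD (Filter.Eventually.mono (source_mem_nhds hx₀)
        fun z hz ↦ smoothAt_constField hz _) (smoothAt_constField hx₀ v)
    rw [smoothAt_iff_coeffs hx₀] at h1
    have h2 := ContMDiffAt.comp_of_eq (x := (0 : ℝ)) (f := c) h1 (contMDiffAt_chartLine hp0) hc0
    exact (contMDiffAt_iff_contDiffAt.1 h2).of_le (by simp)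
  -- The parallel transport equation `V' = -∑ Vⁱ Γᵢ(t)` depends on time; adjoining time as a first
  -- component makes it autonomous.
  let F : ℝ × 𝔼 → ℝ × 𝔼 := fun z ↦ (1, -∑ i, z.2 i • Γ i z.1)
  have hF : ContDiffAt ℝ 1 F (0, w) := by
    refine contDiffAt_const.prodMk (ContDiffAt.neg (ContDiffAt.sum fun i _ ↦ ?_))
    have h1 : ContDiffAt ℝ 1 (fun z : ℝ × 𝔼 ↦ z.2 i) (0, w) :=
      ((EuclideanSpace.proj (𝕜 := ℝ) i : 𝔼 →L[ℝ] ℝ).contDiff.contDiffAt).comp (0, w)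
        contDiffAt_snd
    have h2 : ContDiffAt ℝ 1 (fun z : ℝ × 𝔼 ↦ Γ i z.1) (0, w) :=
      ContDiffAt.comp (g := Γ i) (f := Prod.fst) (0, w) (hΓ i) contDiffAt_fst
    exact h1.smul h2
  obtain ⟨α, hα0, ε, hε, hα⟩ :=
    hF.exists_forall_mem_closedBall_exists_eq_forall_mem_Ioo_hasDerivAt₀ 0
  simp only [zero_sub, zero_add] at hα
  have hα1 : ∀ t ∈ Ioo (-ε) ε, HasDerivAt (fun t ↦ (α t).1) (F (α t)).1 t := fun t ht ↦
    (ContinuousLinearMap.fst ℝ ℝ 𝔼).hasFDerivAt.comp_hasDerivAt t (hα t ht)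
  have hα2 : ∀ t ∈ Ioo (-ε) ε, HasDerivAt (fun t ↦ (α t).2) (F (α t)).2 t := fun t ht ↦
    (ContinuousLinearMap.snd ℝ ℝ 𝔼).hasFDerivAt.comp_hasDerivAt t (hα t ht)
  have hτ : ∀ t ∈ Ioo (-ε) ε, (α t).1 = t := by
    have : EqOn (fun t ↦ (α t).1) id (Ioo (-ε) ε) := by
      refine isOpen_Ioo.eqOn_of_deriv_eq isPreconnected_Ioo
        (fun t ht ↦ (hα1 t ht).differentiableAt.differentiableWithinAt)
        differentiableOn_id (fun t ht ↦ ?_) (x := 0) ⟨by linarith, hε⟩ (by simp [hα0])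
      rw [(hα1 t ht).deriv, deriv_id]
    exact this
  let V : ℝ → 𝔼 := fun t ↦ (α t).2
  have hV : ∀ t ∈ Ioo (-ε) ε, HasDerivAt V (-∑ i, V t i • Γ i t) t := by
    intro t ht
    have := hα2 t ht
    simp only [F, hτ t ht] at this
    exact this
  obtain ⟨δ, hδ, hδε, hδt⟩ : ∃ δ > 0, δ ≤ ε ∧
      ∀ t ∈ Ioo (-δ) δ, p + t • v ∈ (extChartAt (𝓡 m) x₀).target := by
    have hcont : ContinuousAt (fun t : ℝ ↦ p + t • v) 0 := by fun_prop
    have := hcont.eventually_mem ((isOpen_extChartAt_target x₀).mem_nhds hp0)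
    obtain ⟨δ, hδ, h⟩ := Metric.eventually_nhds_iff.1 this
    refine ⟨min δ ε, lt_min hδ hε, min_le_right _ _, fun t ht ↦ h ?_⟩
    rw [Real.dist_eq, sub_zero, abs_lt]
    exact ⟨by linarith [ht.1, min_le_left δ ε], ht.2.trans_le (min_le_left _ _)⟩
  -- A functional with `l v = 1` recovers the parameter `t` from the point on the line. The solution
  -- extends to a field whose coefficients are constant on the level sets of `θ`; this needs `v ≠
  -- 0`.
  obtain ⟨l, hl⟩ := SeparatingDual.exists_eq_one (R := ℝ) hv
  let θ : M → ℝ := fun z ↦ l (extChartAt (𝓡 m) x₀ z - p)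
  have hθ : ∀ t ∈ Ioo (-δ) δ, θ (c t) = t := by
    intro t ht
    simp only [θ, hc, extChartAt_chartLine (hδt t ht), add_sub_cancel_left, map_smul, hl,
      smul_eq_mul, mul_one]
  have hθd : ∀ z ∈ (chartAt 𝔼 x₀).source, MDifferentiableAt (𝓡 m) 𝓘(ℝ) θ z := by
    intro z hz
    refine (l.differentiableAt.mdifferentiableAt).comp z (f := fun z ↦ extChartAt (𝓡 m) x₀ z - p) ?_
    exact (mdifferentiableAt_extChartAt hz).sub mdifferentiableAt_const
  let Y : VField m M := fun z ↦ constField x₀ (V (θ z)) z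
  refine ⟨Y, δ, hδ, ?_, fun t ht ↦ ?_⟩
  · simp [Y, V, θ, hp, hα0]
  have htε : t ∈ Ioo (-ε) ε := ⟨by linarith [ht.1], by linarith [ht.2]⟩
  have hmem := hδt t ht
  have hy : c t ∈ (chartAt 𝔼 x₀).source := chartLine_mem hmem
  have hcd : MDifferentiableAt 𝓘(ℝ) (𝓡 m) c t :=
    (contMDiffAt_chartLine hmem).mdifferentiableAt (by simp)
  have hYd : Y.DiffAt (c t) := by
    rw [diffAt_iff_coeffs hy]
    have : MDifferentiableAt (𝓡 m) 𝓘(ℝ, 𝔼) (fun z ↦ V (θ z)) (c t) := by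
      refine MDifferentiableAt.comp (c t) (I' := 𝓘(ℝ)) (g := V) (f := θ) ?_ (hθd _ hy)
      rw [hθ t ht]
      exact (hV t htε).differentiableAt.mdifferentiableAt
    refine this.congr_of_eventuallyEq ?_
    filter_upwards [source_mem_nhds hy] with z hz
    exact coeffs_constField hz _
  refine ⟨hmem, hYd, ?_⟩
  have hvel : velocity c t = constField x₀ v (c t) := velocity_chartLine hmem
  have hcoef : ∀ i, dirDeriv (fun z ↦ coeffs x₀ z (Y z) i) (c t) (velocity (m := m) c t)
      = (-∑ j, V t j • Γ j t) i := by
    intro i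
    have h1 := hasDerivAt_comp_curve
      (mdifferentiableAt_euclidean_iff.1 ((diffAt_iff_coeffs hy).1 hYd) i) hcd
    have h2 : HasDerivAt (fun s ↦ V s i) ((-∑ j, V t j • Γ j t) i) t :=
      (EuclideanSpace.proj (𝕜 := ℝ) i : 𝔼 →L[ℝ] ℝ).hasFDerivAt.comp_hasDerivAt t (hV t htε)
    refine h1.unique (h2.congr_of_eventuallyEq ?_)
    filter_upwards [eventually_mem_source hcd hy, Ioo_mem_nhds ht.1 ht.2] with s hs hs'
    simp only [Y]
    rw [coeffs_constField hs, hθ s hs']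
  rw [connection_eq_sum D hy hYd, Finset.sum_add_distrib]
  simp only [hcoef]
  rw [← constField_eq_sum hy]
  have hYc : coeffs x₀ (c t) (Y (c t)) = V t := by
    simp only [Y]
    rw [coeffs_constField hy, hθ t ht]
  rw [hYc, hvel, constField_eq_symmL hy]
  simp only [map_neg, map_sum, map_smul]
  simp only [← constField_eq_symmL hy, Γ, constField_coeffs hy]
  exact neg_add_cancel _

/-- Extend `w` to a field `Y` that is `D`-parallel along a line with velocity `v`. Then `⟨Y, Y⟩`
stays zero on the line, and differentiating it with the metric connection gives `⟨∇_v Y, Y⟩ = 0`,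
while `D_v Y = 0` means `A(v, w) = -∇_v Y`. -/
lemma inner_diffTensor_eq_zero [T2Space M] {g : LorentzMetric m M} {D : Connection m M}
    (hD : D.ContMDiffCovariantDerivative ∞) (hcone : PreservesLightCones g D) {x : M}
    (v w : TangentSpace (𝓡 m) x) (hw : g.inner x w w = 0) :
    g.inner x (diffTensor D g.leviCivita x w v) w = 0 := by
  by_cases hv : v = 0
  · simp [hv]
  have hx : x ∈ (chartAt 𝔼 x).source := mem_chart_source _ x
  have hv' : coeffs x x v ≠ 0 := by
    intro h
    apply hv
    rw [← constField_coeffs hx v, h, constField_eq_symmL hx, map_zero]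
  obtain ⟨Y, δ, hδ, hYx, hY⟩ := exists_parallel_field hD hv' (coeffs x x w)
  rw [constField_coeffs hx] at hYx
  set c := chartLine x (extChartAt (𝓡 m) x x) (coeffs x x v) with hc
  have hc0 : c 0 = x := by simp [hc, chartLine]
  have hcd : ∀ t ∈ Ioo (-δ) δ, MDifferentiableAt 𝓘(ℝ) (𝓡 m) c t := fun t ht ↦
    (contMDiffAt_chartLine (hY t ht).1).mdifferentiableAt (by simp)
  have h0 : (0 : ℝ) ∈ Ioo (-δ) δ := ⟨by linarith, hδ⟩
  have hnull : ∀ t ∈ Ioo (-δ) δ, g.inner (c t) (Y (c t)) (Y (c t)) = 0 := by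
    intro t ht
    refine hcone (-δ) δ c (fun t ↦ Y (c t)) (fun t ht ↦
      (contMDiffAt_chartLine (hY t ht).1).contMDiffWithinAt) (fun t ht ↦ ⟨?_, ?_⟩) 0 h0 t ht ?_
    · exact (hY t ht).2.1.comp t (hcd t ht)
    · rw [covDerivAlong_comp D (hcd t ht) (hY t ht).2.1]
      exact (hY t ht).2.2
    · rw [hc0, hYx, hw]
  have hY0 := (hY 0 h0).2.1
  have h1 := hasDerivAt_comp_curve (g.mdifferentiableAt_inner hY0 hY0) (hcd 0 h0)
  have h2 : HasDerivAt (fun s ↦ g.inner (c s) (Y (c s)) (Y (c s))) 0 0 := by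
    refine (hasDerivAt_const (0 : ℝ) (0 : ℝ)).congr_of_eventuallyEq ?_
    filter_upwards [Ioo_mem_nhds h0.1 h0.2] with s hs
    exact hnull s hs
  have h3 := h1.unique h2
  have hvel : velocity c 0 = constField x (coeffs x x v) (c 0) := velocity_chartLine (hY 0 h0).1
  have hpar := (hY 0 h0).2.2
  rw [hvel] at h3 hpar
  rw [hc0] at h3 hpar hY0
  rw [constField_coeffs hx] at h3 hpar
  rw [g.isMetricFor_leviCivita Y Y x hY0 hY0 v, g.symm x (Y x)] at h3
  rw [← hYx, diffTensor_apply D _ hY0, hpar, zero_sub, map_neg, neg_apply]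
  linarith

/-- A symmetric connection that preserves the light cones is a Weyl connection. -/
lemma exists_weyl_field [T2Space M] {g : LorentzMetric m M} {D : Connection m M}
    (hD : D.ContMDiffCovariantDerivative ∞) (hsymm : D.torsion = 0)
    (hcone : PreservesLightCones g D) :
    ∃ P : VField m M, ∀ x (v w : TangentSpace (𝓡 m) x), diffTensor D g.leviCivita x v w
      = g.inner x (P x) v • w + g.inner x (P x) w • v - g.inner x v w • P x := by
  have h := fun x ↦ g.exists_eq_weyl (A := diffTensor D g.leviCivita x)
    (diffTensor_symm hsymm g.torsion_leviCivita) fun v w hw ↦ by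
      rw [diffTensor_symm hsymm g.torsion_leviCivita]
      exact inner_diffTensor_eq_zero hD hcone v w hw
  choose P hP using h
  exact ⟨P, hP⟩

/-- `D` is the Weyl connection with vector field `P`, relative to the metric `g`. -/
def IsWeyl (g : LorentzMetric m M) (D : Connection m M) (P : VField m M) : Prop :=
  ∀ x (v w : TangentSpace (𝓡 m) x), diffTensor D g.leviCivita x v w
    = g.inner x (P x) v • w + g.inner x (P x) w • v - g.inner x v w • P x

/-! ### Differentiability of the Weyl vector field -/

section Regularity

variable {g : LorentzMetric m M} {D : Connection m M} {P : VField m M}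

/-- `P` is chosen point by point, so its regularity must be recovered. For a local timelike field
`N` the Weyl form gives `⟨P, v⟩ ⟨N, N⟩ = ⟨D_v N, N⟩ - ½ v⟨N, N⟩`; being metric lets `∇` disappear,
so only smoothness of `D` and `g` enters. -/
lemma IsWeyl.mdifferentiableAt_inner_const [T2Space M] (hP : IsWeyl g D P)
    (hD : D.ContMDiffCovariantDerivative ∞) (x : M) (a : 𝔼) :
    MDifferentiableAt (𝓡 m) 𝓘(ℝ) (fun y ↦ g.inner y (P y) (constField x a y)) x := by
  have hx : x ∈ (chartAt 𝔼 x).source := mem_chart_source _ x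
  obtain ⟨n, hn, -⟩ := g.signature x
  set N : VField m M := constField x (coeffs x x n) with hN
  have hNx : N x = n := constField_coeffs hx n
  have hNs : ∀ y ∈ (chartAt 𝔼 x).source, N.SmoothAt y := fun y hy ↦ smoothAt_constField hy _
  have has : ∀ y ∈ (chartAt 𝔼 x).source, VField.SmoothAt (constField x a) y :=
    fun y hy ↦ smoothAt_constField hy _
  have hNN := g.contMDiffAt_inner (hNs x hx) (hNs x hx)
  have h1 : ContMDiffAt (𝓡 m) 𝓘(ℝ) ∞ (fun y ↦ g.inner y (D N y (constField x a y)) (N y)) x :=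
    g.contMDiffAt_inner (smoothAt_connection hD
      (Filter.Eventually.mono (source_mem_nhds hx) hNs) (has x hx)) (hNs x hx)
  have h2 := contMDiffAt_dirDeriv hNN (has x hx)
  have hNN0 : g.inner x (N x) (N x) ≠ 0 := by rw [hNx]; exact hn.ne
  have h3 : ContMDiffAt (𝓡 m) 𝓘(ℝ) ∞ (fun y ↦ (g.inner y (D N y (constField x a y)) (N y)
      - (1 / 2) * dirDeriv (fun y ↦ g.inner y (N y) (N y)) y (constField x a y))
      / g.inner y (N y) (N y)) x :=
    (h1.sub (contMDiffAt_const.mul h2)).div₀ hNN hNN0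
  refine (h3.mdifferentiableAt (by simp)).congr_of_eventuallyEq ?_
  filter_upwards [source_mem_nhds hx, hNN.continuousAt.eventually_ne hNN0] with y hy hy0
  have hd := (hNs y hy).diffAt
  rw [g.isMetricFor_leviCivita N N y hd hd, g.symm y (N y), eq_div_iff hy0]
  have h := congrArg (fun v ↦ g.inner y v (N y)) (hP y (N y) (constField x a y))
  simp only [diffTensor_apply D _ hd, map_sub, map_add, map_smul, sub_apply, add_apply, smul_apply,
    smul_eq_mul, g.symm y (N y) (constField x a y)] at h
  linear_combination -h

/-- Raising the index: the Gram matrix `G` is differentiable and invertible, and inversion of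
operators is differentiable. -/
lemma IsWeyl.diffAt [T2Space M] (hP : IsWeyl g D P) (hD : D.ContMDiffCovariantDerivative ∞)
    (x : M) : P.DiffAt x := by
  have hx : x ∈ (chartAt 𝔼 x).source := mem_chart_source _ x
  let E : Fin m → Fin m → 𝔼 →L[ℝ] 𝔼 := fun i j ↦
    (EuclideanSpace.proj (𝕜 := ℝ) i : 𝔼 →L[ℝ] ℝ).smulRight (EuclideanSpace.single j (1 : ℝ))
  let G : M → 𝔼 →L[ℝ] 𝔼 := fun y ↦
    ∑ i, ∑ j, g.inner y (frameField x i y) (frameField x j y) • E i j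
  let ψ : M → 𝔼 := fun y ↦
    ∑ j, g.inner y (P y) (frameField x j y) • EuclideanSpace.single j (1 : ℝ)
  have hG : MDifferentiableAt (𝓡 m) 𝓘(ℝ, 𝔼 →L[ℝ] 𝔼) G x :=
    mdifferentiableAt_sum _ fun i ↦ mdifferentiableAt_sum _ fun j ↦
      (g.mdifferentiableAt_inner (diffAt_constField hx _) (diffAt_constField hx _)).smul
        mdifferentiableAt_const
  have hψ : MDifferentiableAt (𝓡 m) 𝓘(ℝ, 𝔼) ψ x :=
    mdifferentiableAt_sum _ fun j ↦ (hP.mdifferentiableAt_inner_const hD x _).smul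
      mdifferentiableAt_const
  have hGapply : ∀ y ∈ (chartAt 𝔼 x).source, ∀ a,
      G y a = ∑ j, g.inner y (constField x a y) (frameField x j y)
        • EuclideanSpace.single j (1 : ℝ) := by
    intro y hy a
    simp only [G, E, sum_apply, smul_apply, ContinuousLinearMap.smulRight_apply]
    rw [Finset.sum_comm]
    refine Finset.sum_congr rfl fun j _ ↦ ?_
    rw [constField_eq_sum hy a]
    simp only [map_sum, map_smul, sum_apply, smul_apply, smul_eq_mul, smul_smul, Finset.sum_smul]
    exact Finset.sum_congr rfl fun i _ ↦ by rw [mul_comm]; rfl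
  have hinj : ∀ y ∈ (chartAt 𝔼 x).source, ∃ e : 𝔼 ≃L[ℝ] 𝔼, (e : 𝔼 →L[ℝ] 𝔼) = G y := by
    intro y hy
    have : Function.Injective (G y : 𝔼 →ₗ[ℝ] 𝔼) := by
      refine (injective_iff_map_eq_zero _).2 fun a ha ↦ ?_
      have ha' : G y a = 0 := ha
      rw [hGapply y hy] at ha'
      have h0 : constField x a y = 0 := by
        refine g.nondegenerate fun w ↦ ?_
        rw [← sum_coeffs hy w, map_sum]
        refine Finset.sum_eq_zero fun j _ ↦ ?_
        have := congrArg (fun b : 𝔼 ↦ b j) ha'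
        simp [Finset.sum_apply, Pi.single_apply] at this
        rw [map_smul, this, smul_zero]
      rw [← coeffs_constField hy a, h0, ← coeffsL_apply hy, map_zero]
    exact ⟨(LinearEquiv.ofInjectiveEndo _ this).toContinuousLinearEquiv, by ext; rfl⟩
  have hpeq : ∀ y ∈ (chartAt 𝔼 x).source, coeffs x y (P y) = (G y).inverse (ψ y) := by
    intro y hy
    obtain ⟨e, he⟩ := hinj y hy
    have : ψ y = G y (coeffs x y (P y)) := by
      rw [hGapply y hy, constField_coeffs hy]
    rw [this, ← he, ContinuousLinearMap.inverse_equiv]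
    simp
  rw [diffAt_iff_coeffs hx]
  obtain ⟨e, he⟩ := hinj x hx
  have hinv : MDifferentiableAt (𝓡 m) 𝓘(ℝ, 𝔼 →L[ℝ] 𝔼) (fun y ↦ (G y).inverse) x := by
    have h1 : DifferentiableAt ℝ (ContinuousLinearMap.inverse : (𝔼 →L[ℝ] 𝔼) → 𝔼 →L[ℝ] 𝔼) (G x) := by
      rw [← he]
      exact (contDiffAt_map_inverse (n := 1) e).differentiableAt (by simp)
    exact h1.mdifferentiableAt.comp x hG
  refine (hinv.clm_apply hψ).congr_of_eventuallyEq ?_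
  filter_upwards [source_mem_nhds hx] with y hy
  exact hpeq y hy

end Regularity

/-! ### Curvature and Ricci tensor of a Weyl connection -/

section Ricci

variable {g : LorentzMetric m M} {D : Connection m M} {P : VField m M} {x : M}

lemma IsWeyl.connection_connection [T2Space M] (hP : IsWeyl g D P)
    (hD : D.ContMDiffCovariantDerivative ∞) {Y Z : VField m M}
    (hY : ∀ᶠ y in 𝓝 x, Y.SmoothAt y) (hZ : ∀ᶠ y in 𝓝 x, Z.SmoothAt y)
    (v : TangentSpace (𝓡 m) x) :
    D (fun y ↦ D Z y (Y y)) x v = g.leviCivita (fun y ↦ g.leviCivita Z y (Y y)) x v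
      + diffTensor D g.leviCivita x (g.leviCivita Z x (Y x)
          + diffTensor D g.leviCivita x (Z x) (Y x)) v
      + (g.inner x (P x) (Z x) • g.leviCivita Y x v
        + (g.inner x (g.leviCivita P x v) (Z x) + g.inner x (P x) (g.leviCivita Z x v)) • Y x)
      + (g.inner x (P x) (Y x) • g.leviCivita Z x v
        + (g.inner x (g.leviCivita P x v) (Y x) + g.inner x (P x) (g.leviCivita Y x v)) • Z x)
      - (g.inner x (Z x) (Y x) • g.leviCivita P x v
        + (g.inner x (g.leviCivita Z x v) (Y x) + g.inner x (Z x) (g.leviCivita Y x v)) • P x) := by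
  have hYd := hY.self_of_nhds.diffAt
  have hZd := hZ.self_of_nhds.diffAt
  have hPd := hP.diffAt hD x
  have ha := g.mdifferentiableAt_inner hPd hZd
  have hb := g.mdifferentiableAt_inner hPd hYd
  have hc := g.mdifferentiableAt_inner hZd hYd
  set F : VField m M := fun y ↦ D Z y (Y y) with hF
  have hFd : F.DiffAt x := (smoothAt_connection hD hZ hY.self_of_nhds).diffAt
  set W : VField m M := fun y ↦ g.leviCivita Z y (Y y) with hW
  set fa : M → ℝ := fun y ↦ g.inner y (P y) (Z y) with hfa
  set fb : M → ℝ := fun y ↦ g.inner y (P y) (Y y) with hfb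
  set fc : M → ℝ := fun y ↦ g.inner y (Z y) (Y y) with hfc
  have hdiff : ∀ᶠ y in 𝓝 x, F y = W y + diffTensor D g.leviCivita y (Z y) (Y y) := by
    filter_upwards [hZ] with y hy
    rw [diffTensor_apply D _ hy.diffAt, add_sub_cancel]
  have hWeq : ∀ᶠ y in 𝓝 x, (F - (fa • Y + fb • Z - fc • P)) y = W y := by
    filter_upwards [hdiff] with y hy
    simp only [Pi.sub_apply, Pi.add_apply, Pi.smul_apply', hy, hP y (Z y) (Y y), fa, fb, fc]
    abel
  have hsd : VField.DiffAt (fa • Y + fb • Z - fc • P) x :=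
    ((hYd.smul ha).add (hZd.smul hb)).sub (hPd.smul hc)
  -- Differentiability of `∇_Y Z` is obtained from that of `D_Y Z` and of the Weyl correction.
  have hWd : W.DiffAt x := (hFd.sub hsd).congr hWeq
  have hFW : ∀ᶠ y in 𝓝 x, F y = (W + (fa • Y + fb • Z - fc • P)) y := by
    filter_upwards [hWeq] with y hy
    rw [Pi.add_apply, ← hy]
    simp only [Pi.sub_apply]
    abel
  have e1 : D F x v = g.leviCivita F x v + diffTensor D g.leviCivita x (F x) v := by
    rw [diffTensor_apply D _ hFd, add_sub_cancel]
  have e2 : dirDeriv fa x v = _ := g.isMetricFor_leviCivita P Z x hPd hZd v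
  have e3 : dirDeriv fb x v = _ := g.isMetricFor_leviCivita P Y x hPd hYd v
  have e4 : dirDeriv fc x v = _ := g.isMetricFor_leviCivita Z Y x hZd hYd v
  rw [e1, hdiff.self_of_nhds, connection_congr g.leviCivita hFd hFW,
    connection_add _ hWd hsd, connection_sub _ ((hYd.smul ha).add (hZd.smul hb)) (hPd.smul hc),
    connection_add _ (hYd.smul ha) (hZd.smul hb)]
  simp only [add_apply, sub_apply]
  rw [connection_smul _ ha hYd, connection_smul _ hb hZd, connection_smul _ hc hPd, e2, e3, e4]
  simp only [fa, fb, fc, map_add, add_apply]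
  abel

/-- The change of the curvature under passage to a Weyl connection. -/
lemma IsWeyl.curvature_sub [T2Space M] (hP : IsWeyl g D P)
    (hD : D.ContMDiffCovariantDerivative ∞) {X Y Z : VField m M}
    (hX : ∀ᶠ y in 𝓝 x, X.SmoothAt y) (hY : ∀ᶠ y in 𝓝 x, Y.SmoothAt y)
    (hZ : ∀ᶠ y in 𝓝 x, Z.SmoothAt y) :
    curvature D X Y Z x - curvature g.leviCivita X Y Z x =
      (g.inner x (g.leviCivita P x (X x)) (Y x) - g.inner x (g.leviCivita P x (Y x)) (X x)) • Z x
      + g.inner x (g.leviCivita P x (X x)) (Z x) • Y x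
      - g.inner x (g.leviCivita P x (Y x)) (Z x) • X x
      - g.inner x (Y x) (Z x) • g.leviCivita P x (X x)
      + g.inner x (X x) (Z x) • g.leviCivita P x (Y x)
      - (g.inner x (P x) (X x) * g.inner x (P x) (Z x)) • Y x
      + (g.inner x (P x) (Y x) * g.inner x (P x) (Z x)) • X x
      - (g.inner x (P x) (P x) * g.inner x (Y x) (Z x)) • X x
      + (g.inner x (P x) (P x) * g.inner x (X x) (Z x)) • Y x
      + (g.inner x (P x) (X x) * g.inner x (Y x) (Z x)
        - g.inner x (P x) (Y x) * g.inner x (X x) (Z x)) • P x := by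
  -- Replacing `[X, Y]` by `∇_X Y - ∇_Y X` makes all derivatives of `X`, `Y` and `Z` outside the
  -- Levi-Civita curvature cancel.
  have hbr := ((CovariantDerivative.torsion_eq_zero_iff _).1 g.torsion_leviCivita)
    hX.self_of_nhds.diffAt hY.self_of_nhds.diffAt
  have hDZ : D Z x (mlieBracket (𝓡 m) X Y x) = g.leviCivita Z x (mlieBracket (𝓡 m) X Y x)
      + diffTensor D g.leviCivita x (Z x) (mlieBracket (𝓡 m) X Y x) := by
    rw [diffTensor_apply D _ hZ.self_of_nhds.diffAt, add_sub_cancel]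
  rw [curvature, curvature, hP.connection_connection hD hY hZ, hP.connection_connection hD hX hZ,
    hDZ, ← hbr]
  simp only [hP x _ _, map_sub, map_add, map_smul, sub_apply, add_apply, smul_apply]
  rw [g.symm x (Y x) (X x), g.symm x (Z x) (X x), g.symm x (Z x) (Y x),
    g.symm x (Z x) (g.leviCivita Y x (X x)),
    g.symm x (Z x) (g.leviCivita X x (Y x))]
  module

lemma sum_apply_mul_coeffsL (l : TangentSpace (𝓡 m) x →L[ℝ] ℝ) (V : TangentSpace (𝓡 m) x) :
    ∑ i, l (frameField x i x) * coeffsL x x V i = l V := by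
  have hx : x ∈ (chartAt 𝔼 x).source := mem_chart_source _ x
  conv_rhs => rw [← sum_coeffs hx V]
  simp only [map_sum, map_smul, smul_eq_mul, coeffsL_apply hx]
  exact Finset.sum_congr rfl fun i _ ↦ mul_comm _ _

lemma sum_coeffsL_frameField : ∑ i : Fin m, coeffsL x x (frameField x i x) i = (m : ℝ) := by
  have hx : x ∈ (chartAt 𝔼 x).source := mem_chart_source _ x
  simp [coeffsL_apply hx, frameField, coeffs_constField hx]

/-- The trace of `IsWeyl.curvature_sub` over its second argument: rank-one terms contract by
`sum_apply_mul_coeffsL`, multiples of the identity contribute `m`, and the remaining sum is the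
divergence of `P`. -/
lemma IsWeyl.ricci_sub [T2Space M] (hP : IsWeyl g D P)
    (hD : D.ContMDiffCovariantDerivative ∞) (u w : TangentSpace (𝓡 m) x) :
    ricci D x u w - ricci g.leviCivita x u w =
      ((m : ℝ) - 1) * g.inner x (g.leviCivita P x u) w - g.inner x (g.leviCivita P x w) u
      + g.inner x u w * ∑ i, coeffsL x x (g.leviCivita P x (frameField x i x)) i
      - ((m : ℝ) - 2) * (g.inner x (P x) u * g.inner x (P x) w)
      + ((m : ℝ) - 2) * (g.inner x (P x) (P x) * g.inner x u w) := by
  have hx : x ∈ (chartAt 𝔼 x).source := mem_chart_source _ x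
  have hs : ∀ a : 𝔼, ∀ᶠ y in 𝓝 x, VField.SmoothAt (constField x a) y := fun a ↦
    Filter.Eventually.mono (source_mem_nhds hx) fun y hy ↦ smoothAt_constField hy _
  have hB : ∀ V : TangentSpace (𝓡 m) x, ∀ Q : TangentSpace (𝓡 m) x,
      ∑ i, g.inner x (g.leviCivita P x (frameField x i x)) V * coeffsL x x Q i
        = g.inner x (g.leviCivita P x Q) V := by
    intro V Q
    have := sum_apply_mul_coeffsL (((g.inner x) V).comp (g.leviCivita P x)) Q
    simpa only [ContinuousLinearMap.comp_apply, g.symm x V] using this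
  have hg : ∀ V : TangentSpace (𝓡 m) x, ∀ Q : TangentSpace (𝓡 m) x,
      ∑ i, g.inner x V (frameField x i x) * coeffsL x x Q i = g.inner x V Q :=
    fun V Q ↦ sum_apply_mul_coeffsL (g.inner x V) Q
  rw [ricci, ricci, ← Finset.sum_sub_distrib]
  have key : ∀ i : Fin m,
      coeffs x x (curvature D (constField x (coeffs x x u)) (frameField x i)
          (constField x (coeffs x x w)) x) i
        - coeffs x x (curvature g.leviCivita (constField x (coeffs x x u)) (frameField x i)
          (constField x (coeffs x x w)) x) i
      = g.inner x (g.leviCivita P x u) (frameField x i x) * coeffsL x x w i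
        - g.inner x (g.leviCivita P x (frameField x i x)) u * coeffsL x x w i
        + g.inner x (g.leviCivita P x u) w * coeffsL x x (frameField x i x) i
        - g.inner x (g.leviCivita P x (frameField x i x)) w * coeffsL x x u i
        - g.inner x w (frameField x i x) * coeffsL x x (g.leviCivita P x u) i
        + g.inner x u w * coeffsL x x (g.leviCivita P x (frameField x i x)) i
        - g.inner x (P x) u * g.inner x (P x) w * coeffsL x x (frameField x i x) i
        + g.inner x (P x) w * (g.inner x (P x) (frameField x i x) * coeffsL x x u i)
        - g.inner x (P x) (P x) * (g.inner x w (frameField x i x) * coeffsL x x u i)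
        + g.inner x (P x) (P x) * g.inner x u w * coeffsL x x (frameField x i x) i
        + g.inner x (P x) u * (g.inner x w (frameField x i x) * coeffsL x x (P x) i)
        - g.inner x u w * (g.inner x (P x) (frameField x i x) * coeffsL x x (P x) i) := by
    intro i
    rw [← coeffsL_apply hx (curvature D _ _ _ x), ← coeffsL_apply hx (curvature g.leviCivita _ _ _ x),
      ← PiLp.sub_apply, ← map_sub,
      hP.curvature_sub hD (hs _) (hs _) (hs _), constField_coeffs hx, constField_coeffs hx]
    simp only [map_sub, map_add, map_smul, PiLp.sub_apply, PiLp.add_apply, PiLp.smul_apply,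
      smul_eq_mul, g.symm x (frameField x i x) w]
    ring
  simp only [key, Finset.sum_add_distrib, Finset.sum_sub_distrib, ← Finset.mul_sum, hB, hg,
    sum_coeffsL_frameField]
  rw [g.symm x w (g.leviCivita P x u), g.symm x w u, g.symm x w (P x)]
  ring

/-- Equality of the Ricci tensors determines the covariant derivative of the Weyl vector field. -/
lemma IsWeyl.leviCivita_eq [T2Space M] (hm : 2 < m) (hP : IsWeyl g D P)
    (hD : D.ContMDiffCovariantDerivative ∞)
    (hRic : ∀ u w : TangentSpace (𝓡 m) x, ricci D x u w = ricci g.leviCivita x u w)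
    (v : TangentSpace (𝓡 m) x) :
    g.leviCivita P x v
      = g.inner x (P x) v • P x - (g.inner x (P x) (P x) / 2) • v := by
  have hm' : (2 : ℝ) < m := by exact_mod_cast hm
  set q := g.inner x (P x) (P x) with hq
  set d := ∑ i, coeffsL x x (g.leviCivita P x (frameField x i x)) i with hd
  have h1 : ∀ u w, ((m : ℝ) - 1) * g.inner x (g.leviCivita P x u) w
      - g.inner x (g.leviCivita P x w) u + g.inner x u w * d
      - ((m : ℝ) - 2) * (g.inner x (P x) u * g.inner x (P x) w)
      + ((m : ℝ) - 2) * (q * g.inner x u w) = 0 := fun u w ↦ by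
    rw [← hP.ricci_sub hD, hRic u w, sub_self]
  -- The antisymmetric part of `h1` is `m` times that of `∇P`: the one-form dual to `P` is closed.
  have h2 : ∀ u w, g.inner x (g.leviCivita P x u) w = g.inner x (g.leviCivita P x w) u := by
    intro u w
    have ha := h1 u w
    have hb := h1 w u
    rw [g.symm x w u] at hb
    have : (m : ℝ) * (g.inner x (g.leviCivita P x u) w - g.inner x (g.leviCivita P x w) u) = 0 := by
      linear_combination ha - hb
    rcases mul_eq_zero.1 this with h | h
    · linarith
    · linarith
  have h3 : ∀ u, ((m : ℝ) - 2) • (g.leviCivita P x u - g.inner x (P x) u • P x + q • u)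
      + d • u = 0 := by
    intro u
    refine g.nondegenerate fun w ↦ ?_
    simp only [map_sub, map_add, map_smul, sub_apply, add_apply, smul_apply, smul_eq_mul]
    linear_combination h1 u w - h2 u w
  -- The trace of `h3`, which determines the divergence `d`.
  have h4 : ((m : ℝ) - 2) * (d - q + q * m) + d * m = 0 := by
    have := Finset.sum_congr rfl fun (i : Fin m) (_ : i ∈ Finset.univ) ↦
      congrArg (fun z ↦ coeffsL x x z i) (h3 (frameField x i x))
    simp only [map_sub, map_add, map_smul, map_zero, PiLp.sub_apply, PiLp.add_apply,
      PiLp.smul_apply, PiLp.zero_apply, smul_eq_mul, Finset.sum_add_distrib,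
      Finset.sum_sub_distrib, ← Finset.mul_sum, sum_coeffsL_frameField,
      sum_apply_mul_coeffsL (g.inner x (P x)), Finset.sum_const_zero] at this
    exact this
  have h5 : d = -((m : ℝ) - 2) * q / 2 := by
    have : ((m : ℝ) - 1) * (d + ((m : ℝ) - 2) * q / 2) = 0 := by linear_combination h4 / 2
    rcases mul_eq_zero.1 this with h | h
    · linarith
    · linear_combination h
  have h6 : ((m : ℝ) - 2) • (g.leviCivita P x v - (g.inner x (P x) v • P x - (q / 2) • v)) = 0 := by
    rw [← h3 v, h5]
    module
  -- Here `m ≠ 2` is essential.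
  exact sub_eq_zero.1 ((smul_eq_zero.1 h6).resolve_left (by linarith))

end Ricci

/-! ### The Riccati inequality on the whole line -/

/-- A positive value blows up in finite time. From `t₀` on, `u` stays positive and `1/u + t/2` does
not increase, so `1/u ≤ 0` at time `t₀ + 2/u(t₀)`. -/
lemma nonpos_of_sq_le_deriv {u u' : ℝ → ℝ} (hu : ∀ t, HasDerivAt u (u' t) t)
    (h : ∀ t, u t ^ 2 / 2 ≤ u' t) (t₀ : ℝ) : u t₀ ≤ 0 := by
  by_contra! hpos
  have hmono : Monotone u := monotone_of_hasDerivAt_nonneg hu fun t ↦ by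
    have := h t
    have := sq_nonneg (u t)
    simp only [Pi.zero_apply]
    linarith
  have hge : ∀ t ∈ Ici t₀, 0 < u t := fun t ht ↦ hpos.trans_le (hmono ht)
  have hd : ∀ t ∈ Ici t₀, HasDerivAt (fun t ↦ (u t)⁻¹ + t / 2) (-u' t / u t ^ 2 + 1 / 2) t :=
    fun t ht ↦ ((hu t).inv (hge t ht).ne').add ((hasDerivAt_id t).div_const 2)
  have hanti : AntitoneOn (fun t ↦ (u t)⁻¹ + t / 2) (Ici t₀) := by
    refine antitoneOn_of_deriv_nonpos (convex_Ici t₀)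
      (fun t ht ↦ (hd t ht).continuousAt.continuousWithinAt)
      (fun t ht ↦ (hd t (interior_subset ht)).differentiableAt.differentiableWithinAt)
      fun t ht ↦ ?_
    have ht' := interior_subset ht
    rw [(hd t ht').deriv]
    have h2 : 0 < u t ^ 2 := pow_pos (hge t ht') 2
    have : 1 / 2 ≤ u' t / u t ^ 2 := by
      rw [le_div_iff₀ h2]
      linarith [h t]
    rw [neg_div]
    linarith
  have hinv : 0 < (u t₀)⁻¹ := inv_pos.2 hpos
  have h1 : t₀ + 2 * (u t₀)⁻¹ ∈ Ici t₀ := by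
    rw [mem_Ici]
    linarith
  have h2 := hanti self_mem_Ici h1 h1
  have h3 := inv_pos.2 (hge _ h1)
  simp only at h2
  linarith

/-- The only solution of the Riccati inequality `u' ≥ u² / 2` on the whole real line is zero. -/
lemma eq_zero_of_sq_le_deriv {u u' : ℝ → ℝ} (hu : ∀ t, HasDerivAt u (u' t) t)
    (h : ∀ t, u t ^ 2 / 2 ≤ u' t) (t₀ : ℝ) : u t₀ = 0 := by
  refine le_antisymm (nonpos_of_sq_le_deriv hu h t₀) ?_
  -- The inequality is invariant under `u(t) ↦ -u(-t)`; this is where completeness in the past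
  -- enters.
  have := nonpos_of_sq_le_deriv (u := fun t ↦ -u (-t)) (u' := fun t ↦ u' (-t))
    (fun t ↦ by
      have h1 := ((hu (-t)).comp t (hasDerivAt_neg t)).neg
      simpa using! h1)
    (fun t ↦ by simpa using h (-t)) (-t₀)
  simpa using this

lemma mdifferentiableAt_velocity {γ : ℝ → M} (hγ : ContMDiff 𝓘(ℝ) (𝓡 m) ∞ γ) (t : ℝ) :
    MDifferentiableAt 𝓘(ℝ) ((𝓡 m).prod 𝓘(ℝ, 𝔼)) (fun s ↦ TotalSpace.mk' 𝔼
      (E := (TangentSpace (𝓡 m) : M → Type _)) (γ s) (velocity γ s)) t := by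
  have h1 : ContMDiff 𝓘(ℝ).tangent (𝓡 m).tangent ∞ (tangentMap 𝓘(ℝ) (𝓡 m) γ) :=
    hγ.contMDiff_tangentMap (by simp)
  have h2 : ContMDiffAt 𝓘(ℝ) 𝓘(ℝ).tangent ∞
      (fun s : ℝ ↦ (⟨s, (1 : ℝ)⟩ : TangentBundle 𝓘(ℝ) ℝ)) t := by
    rw [contMDiffAt_totalSpace]
    refine ⟨contMDiffAt_id, ?_⟩
    simp only [trivializationAt_model_space_apply]
    exact contMDiffAt_const
  exact ((h1.contMDiffAt.comp t h2)).mdifferentiableAt (by simp)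

/-! ### Vanishing of the Weyl vector field -/

section Vanishing

variable {g : LorentzMetric m M} {D : Connection m M} {P : VField m M}

/-- A vector field `P` with `∇_v P = ⟨P, v⟩ P - ½ ⟨P, P⟩ v` vanishes along complete timelike
geodesics. -/
lemma eq_zero_along_geodesic {γ : ℝ → M} (hγ : IsCompleteGeodesic g.leviCivita γ)
    (ht : ∀ t, g.inner (γ t) (velocity γ t) (velocity γ t) < 0) (hP : ∀ x, P.DiffAt x)
    (hLC : ∀ x (v : TangentSpace (𝓡 m) x), g.leviCivita P x v
      = g.inner x (P x) v • P x - (g.inner x (P x) (P x) / 2) • v) (t : ℝ) :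
    P (γ t) = 0 := by
  set u : ℝ → ℝ := fun s ↦ g.inner (γ s) (P (γ s)) (velocity γ s) with hu
  have hd : ∀ s, HasDerivAt u (u s ^ 2 - g.inner (γ s) (P (γ s)) (P (γ s))
      * g.inner (γ s) (velocity γ s) (velocity γ s) / 2) s := by
    intro s
    refine (g.hasDerivAt_inner_along (mdifferentiableAt_velocity hγ.1 s) (hP _)).congr_deriv ?_
    rw [hγ.2 s, hLC, map_zero, add_zero]
    simp only [map_sub, map_smul, sub_apply, smul_apply, smul_eq_mul, u]
    ring
  -- Reverse Cauchy–Schwarz gives `⟨P, P⟩ ⟨γ', γ'⟩ ≤ u²`, so at least half of `u²` survives in `u'`.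
  have h0 : ∀ s, u s = 0 := eq_zero_of_sq_le_deriv hd fun s ↦ by
    have := g.inner_mul_inner_le_sq (ht s) (P (γ s))
    simp only [u]
    linarith
  have h1 : HasDerivAt u 0 t := by
    have : u = fun _ ↦ 0 := funext h0
    rw [this]
    exact hasDerivAt_const t 0
  have h2 := (hd t).unique h1
  rw [h0 t] at h2
  have h3 : g.inner (γ t) (P (γ t)) (P (γ t)) * g.inner (γ t) (velocity γ t) (velocity γ t) = 0 := by
    linear_combination -2 * h2
  exact g.eq_zero_of_orthogonal_timelike (ht t) (h0 t)
    ((mul_eq_zero.1 h3).resolve_right (ht t).ne)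

/-- The coefficients of a vector field along a straight line in a chart. -/
lemma hasDerivAt_coeffs_chartLine (D : Connection m M) {x₀ : M} {p v : 𝔼} {t : ℝ}
    (h : p + t • v ∈ (extChartAt (𝓡 m) x₀).target) (hP : P.DiffAt (chartLine x₀ p v t)) :
    HasDerivAt (fun s ↦ coeffs x₀ (chartLine x₀ p v s) (P (chartLine x₀ p v s)))
      (coeffsL x₀ (chartLine x₀ p v t) (D P (chartLine x₀ p v t)
          (constField x₀ v (chartLine x₀ p v t)))
        - ∑ i, coeffs x₀ (chartLine x₀ p v t) (P (chartLine x₀ p v t)) i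
          • coeffsL x₀ (chartLine x₀ p v t) (D (frameField x₀ i) (chartLine x₀ p v t)
            (constField x₀ v (chartLine x₀ p v t)))) t := by
  set c := chartLine x₀ p v
  have hy : c t ∈ (chartAt 𝔼 x₀).source := chartLine_mem h
  have hcd : MDifferentiableAt 𝓘(ℝ) (𝓡 m) c t :=
    (contMDiffAt_chartLine h).mdifferentiableAt (by simp)
  have hvel : velocity c t = constField x₀ v (c t) := velocity_chartLine h
  have hPc := (diffAt_iff_coeffs hy).1 hP
  have hf : DifferentiableAt ℝ (fun s ↦ coeffs x₀ (c s) (P (c s))) t :=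
    (hPc.comp t hcd).differentiableAt
  refine hf.hasDerivAt.congr_deriv ?_
  rw [connection_eq_sum D hy hP, Finset.sum_add_distrib, map_add]
  simp only [map_sum, map_smul]
  rw [add_sub_cancel_right]
  ext i
  have h1 := hasDerivAt_comp_curve (mdifferentiableAt_euclidean_iff.1 hPc i) hcd
  have h2 : HasDerivAt (fun s ↦ coeffs x₀ (c s) (P (c s)) i)
      (deriv (fun s ↦ coeffs x₀ (c s) (P (c s))) t i) t :=
    (EuclideanSpace.proj (𝕜 := ℝ) i : 𝔼 →L[ℝ] ℝ).hasFDerivAt.comp_hasDerivAt t hf.hasDerivAt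
  rw [h2.unique h1, hvel]
  simp [coeffsL_apply hy, coeffs_constField hy, frameField, Finset.sum_apply, Pi.single_apply]

/-- The zero set of a vector field with `D_v P = ⟨P, v⟩ P + ½ ⟨P, P⟩ v` is open. -/
lemma eventually_eq_zero [T2Space M] (hD : D.ContMDiffCovariantDerivative ∞)
    (hP : ∀ x, P.DiffAt x)
    (hDP : ∀ x (v : TangentSpace (𝓡 m) x), D P x v
      = g.inner x (P x) v • P x + (g.inner x (P x) (P x) / 2) • v) {x₀ : M} (h0 : P x₀ = 0) :
    ∀ᶠ y in 𝓝 x₀, P y = 0 := by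
  set p := extChartAt (𝓡 m) x₀ x₀ with hp
  have hx₀ : x₀ ∈ (chartAt 𝔼 x₀).source := mem_chart_source _ x₀
  -- Inside a coordinate ball, each nearby `y` is joined to `x₀` by a straight line over `[0, 1]`.
  obtain ⟨r, hr, hball⟩ := Metric.isOpen_iff.1 (isOpen_extChartAt_target (I := 𝓡 m) x₀) p
    (mem_extChartAt_target x₀)
  have hnear : ∀ᶠ y in 𝓝 x₀, extChartAt (𝓡 m) x₀ y ∈ Metric.ball p r :=
    (continuousAt_extChartAt x₀).eventually_mem (Metric.ball_mem_nhds p hr)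
  filter_upwards [hnear, source_mem_nhds hx₀] with y hy hys
  set v := extChartAt (𝓡 m) x₀ y - p with hv
  have hmem : ∀ t ∈ Icc (0 : ℝ) 1, p + t • v ∈ (extChartAt (𝓡 m) x₀).target := by
    intro t ht
    refine hball ?_
    rw [mem_ball_iff_norm, add_sub_cancel_left, norm_smul, Real.norm_of_nonneg ht.1]
    rw [mem_ball_iff_norm] at hy
    calc t * ‖v‖ ≤ 1 * ‖v‖ := by gcongr; exact ht.2
      _ < r := by rwa [one_mul]
  set c := chartLine x₀ p v with hc
  have hc0 : c 0 = x₀ := by simp [hc, chartLine, hp]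
  have hc1 : c 1 = y := by
    simp only [hc, chartLine, one_smul, hv, add_sub_cancel]
    exact (extChartAt (𝓡 m) x₀).left_inv (by rwa [extChartAt_source])
  have hcs : ∀ t ∈ Icc (0 : ℝ) 1, c t ∈ (chartAt 𝔼 x₀).source := fun t ht ↦ chartLine_mem (hmem t ht)
  have hcc : ∀ t ∈ Icc (0 : ℝ) 1, ContinuousAt c t := fun t ht ↦
    (contMDiffAt_chartLine (hmem t ht)).continuousAt
  -- The equation is used for `D` instead of `∇` because continuity of these coefficients follows
  -- from the smoothness of `D`.
  let Γ : Fin m → ℝ → 𝔼 := fun i t ↦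
    coeffsL x₀ (c t) (D (frameField x₀ i) (c t) (constField x₀ v (c t)))
  have hΓ : ∀ i, ContinuousOn (Γ i) (Icc 0 1) := by
    intro i t ht
    have h1 : VField.SmoothAt (fun z ↦ D (frameField x₀ i) z (constField x₀ v z)) (c t) :=
      smoothAt_connection hD (Filter.Eventually.mono (source_mem_nhds (hcs t ht))
        fun z hz ↦ smoothAt_constField hz _) (smoothAt_constField (hcs t ht) v)
    rw [smoothAt_iff_coeffs (hcs t ht)] at h1
    refine (ContinuousWithinAt.congr (f := fun s ↦ coeffs x₀ (c s) (D (frameField x₀ i) (c s)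
      (constField x₀ v (c s)))) ?_ (fun s hs ↦ coeffsL_apply (hcs s hs) _)
      (coeffsL_apply (hcs t ht) _))
    exact (ContinuousAt.comp (f := c) h1.continuousAt (hcc t ht)).continuousWithinAt
  have hg : ∀ a : 𝔼, ContinuousOn (fun t ↦ g.inner (c t) (P (c t)) (constField x₀ a (c t)))
      (Icc 0 1) := fun a t ht ↦
    (ContinuousAt.comp (f := c) (g.mdifferentiableAt_inner (hP _)
      (diffAt_constField (hcs t ht) a)).continuousAt (hcc t ht)).continuousWithinAt
  -- The equation is quadratic in `P`, but one factor of `P` can be absorbed into a continuous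
  -- coefficient. This makes the bound linear in `‖f‖`, with `k` bounded on the compact interval.
  let k : ℝ → ℝ := fun t ↦ |g.inner (c t) (P (c t)) (constField x₀ v (c t))|
    + (∑ i, |g.inner (c t) (P (c t)) (frameField x₀ i (c t))|) / 2 * ‖v‖ + ∑ i, ‖Γ i t‖
  have hk : ContinuousOn k (Icc 0 1) := by
    refine ((hg v).abs.add (ContinuousOn.mul (ContinuousOn.div_const ?_ 2) continuousOn_const)).add ?_
    · exact continuousOn_finsetSum _ fun i _ ↦ (hg _).abs
    · exact continuousOn_finsetSum _ fun i _ ↦ (hΓ i).norm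
  obtain ⟨K, hK⟩ := isCompact_Icc.exists_bound_of_continuousOn hk
  let f : ℝ → 𝔼 := fun t ↦ coeffs x₀ (c t) (P (c t))
  have hf : ∀ t ∈ Icc (0 : ℝ) 1, HasDerivAt f (g.inner (c t) (P (c t)) (constField x₀ v (c t)) • f t
      + (g.inner (c t) (P (c t)) (P (c t)) / 2) • v - ∑ i, f t i • Γ i t) t := by
    intro t ht
    refine (hasDerivAt_coeffs_chartLine D (hmem t ht) (hP _)).congr_deriv ?_
    rw [hDP, map_add, map_smul, map_smul, coeffsL_apply (hcs t ht), coeffsL_apply (hcs t ht),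
      coeffs_constField (hcs t ht)]
  have hcoord : ∀ t i, |f t i| ≤ ‖f t‖ := fun t i ↦ PiLp.norm_apply_le (f t) i
  have hbound : ∀ t ∈ Icc (0 : ℝ) 1, ‖g.inner (c t) (P (c t)) (constField x₀ v (c t)) • f t
      + (g.inner (c t) (P (c t)) (P (c t)) / 2) • v - ∑ i, f t i • Γ i t‖ ≤ K * ‖f t‖ := by
    intro t ht
    have hq : |g.inner (c t) (P (c t)) (P (c t))|
        ≤ ‖f t‖ * ∑ i, |g.inner (c t) (P (c t)) (frameField x₀ i (c t))| := by
      have hsum := congrArg (g.inner (c t) (P (c t))) (sum_coeffs (hcs t ht) (P (c t)))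
      rw [map_sum] at hsum
      rw [← hsum, Finset.mul_sum]
      refine (Finset.abs_sum_le_sum_abs _ _).trans (Finset.sum_le_sum fun i _ ↦ ?_)
      rw [map_smul, smul_eq_mul, abs_mul]
      exact mul_le_mul_of_nonneg_right (hcoord t i) (abs_nonneg _)
    have hs : ‖∑ i, f t i • Γ i t‖ ≤ ‖f t‖ * ∑ i, ‖Γ i t‖ := by
      rw [Finset.mul_sum]
      refine (norm_sum_le _ _).trans (Finset.sum_le_sum fun i _ ↦ ?_)
      rw [norm_smul, Real.norm_eq_abs]
      exact mul_le_mul_of_nonneg_right (hcoord t i) (norm_nonneg _)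
    calc _ ≤ ‖g.inner (c t) (P (c t)) (constField x₀ v (c t)) • f t‖
          + ‖(g.inner (c t) (P (c t)) (P (c t)) / 2) • v‖ + ‖∑ i, f t i • Γ i t‖ :=
          (norm_sub_le _ _).trans (by gcongr; exact norm_add_le _ _)
      _ ≤ |g.inner (c t) (P (c t)) (constField x₀ v (c t))| * ‖f t‖
          + (‖f t‖ * ∑ i, |g.inner (c t) (P (c t)) (frameField x₀ i (c t))|) / 2 * ‖v‖
          + ‖f t‖ * ∑ i, ‖Γ i t‖ := by
          rw [norm_smul, norm_smul, Real.norm_eq_abs, Real.norm_eq_abs, abs_div, abs_two]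
          gcongr
      _ = k t * ‖f t‖ := by simp only [k]; ring
      _ ≤ K * ‖f t‖ := by
          gcongr
          exact (le_abs_self _).trans (hK t ht)
  have hf0 : f 0 = 0 := by
    simp only [f]
    rw [hc0, h0, ← coeffsL_apply hx₀, map_zero]
  have hz := eq_zero_of_abs_deriv_le_mul_abs_self_of_eq_zero_right
    (fun t ht ↦ (hf t ht).continuousAt.continuousWithinAt)
    (fun t ht ↦ (hf t (Ico_subset_Icc_self ht)).hasDerivWithinAt) hf0
    (fun t ht ↦ hbound t (Ico_subset_Icc_self ht)) 1 (right_mem_Icc.2 zero_le_one)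
  simp only [f] at hz
  rw [hc1] at hz
  rw [← constField_coeffs hys (P y), hz, constField_eq_symmL hys, map_zero]

lemma eventually_ne_zero (hP : ∀ x, P.DiffAt x) {x₀ : M} (h0 : P x₀ ≠ 0) :
    ∀ᶠ y in 𝓝 x₀, P y ≠ 0 := by
  have hx₀ : x₀ ∈ (chartAt 𝔼 x₀).source := mem_chart_source _ x₀
  have h1 : coeffs x₀ x₀ (P x₀) ≠ 0 := by
    intro h
    rw [← constField_coeffs hx₀ (P x₀), h, constField_eq_symmL hx₀, map_zero] at h0
    exact h0 rfl
  filter_upwards [((diffAt_iff_coeffs hx₀).1 (hP x₀)).continuousAt.eventually_ne h1,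
    source_mem_nhds hx₀] with y hy hys h
  rw [h, ← coeffsL_apply hys, map_zero] at hy
  exact hy rfl

end Vanishing

end Spacetime

end

/-! ### Conclusion by connectedness -/

open Spacetime in
theorem theorem1p8 {m : ℕ} (hm : 2 < m) {M : Type*} [TopologicalSpace M] [T2Space M]
    [SecondCountableTopology M] [ConnectedSpace M] [ChartedSpace (EuclideanSpace ℝ (Fin m)) M]
    [IsManifold (𝓡 m) ∞ M]
    (g : LorentzMetric m M) (hg : IsViable g)
    (D : Connection m M) (hD : D.ContMDiffCovariantDerivative ∞) (hsymm : D.torsion = 0)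
    (hcone : PreservesLightCones g D)
    (hRic : ∀ (x : M) (u w : TangentSpace (𝓡 m) x), ricci D x u w = ricci g.leviCivita x u w) :
    ∀ (Y : VField m M) (x : M), Y.DiffAt x → D Y x = g.leviCivita Y x := by
  obtain ⟨P, hP⟩ : ∃ P, IsWeyl g D P := exists_weyl_field hD hsymm hcone
  have hPd := hP.diffAt hD
  have hLC := fun x v ↦ hP.leviCivita_eq hm hD (hRic x) v
  -- The Weyl form gives `A(P, v) = ⟨P, P⟩ v`, which turns `-½ ⟨P, P⟩ v` into `+½ ⟨P, P⟩ v`.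
  have hDP : ∀ x (v : TangentSpace (𝓡 m) x), D P x v
      = g.inner x (P x) v • P x + (g.inner x (P x) (P x) / 2) • v := by
    intro x v
    have h1 := diffTensor_apply D g.leviCivita (hPd x) v
    rw [hP, hLC] at h1
    rw [← sub_add_cancel (D P x v) (g.leviCivita P x v), hLC, ← h1]
    module
  obtain ⟨γ, hγ, hγt⟩ := hg
  have hclopen : IsClopen {x | P x = 0} :=
    ⟨⟨isOpen_iff_mem_nhds.2 fun _ hx ↦ eventually_ne_zero hPd hx⟩,
      isOpen_iff_mem_nhds.2 fun _ hx ↦ eventually_eq_zero hD hPd hDP hx⟩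
  have huniv := hclopen.eq_univ ⟨γ 0, eq_zero_along_geodesic hγ hγt hPd hLC 0⟩
  intro Y x hY
  ext1 v
  have hPx : P x = 0 := eq_univ_iff_forall.1 huniv x
  rw [← sub_eq_zero, ← diffTensor_apply D g.leviCivita hY, hP, hPx]
  simp
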